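/- Let $\Lambda^{\frac\infty2}V$ be the infinite wedge space: the complex vector space with basis $v_S=\underline{s_1}\wedge\underline{s_2}\wedge\cdots$ indexed by the subsets $S=\{s_1>s_2>\dots\}\subset\mathbb Z+\frac12$ that have finitely many positive elements and omit finitely many negative half-integers, with the inner product for which the $v_S$ are orthonormal. Let $\psi_k$ be wedge product with $\underline k$ from the left, $\psi_k^*$ its adjoint, and let $E_{ij}$ act by $\psi_i\psi_j^*$ if $j>0$ and by $-\psi_j^*\psi_i$ if $j<0$. Let $v_\emptyset=\underline{-\frac12}\wedge\underline{-\frac32}\wedge\cdots$. Put $\varsigma(z)=e^{z/2}-e^{-z/2}$, $\mathcal S(z)=\varsigma(z)/z$, $$\mathcal E_r(z)=\sum_{k\in\mathbb Z+\frac12}e^{z(k-\frac r2)}E_{k-r,k}+\frac{\delta_{r,0}}{\varsigma(z)},\qquad r\in\mathbb Z,$$ $$\mathsf A(z)=\mathcal S(z)^{tz}\sum_{n\in\mathbb Z}\frac{\varsigma(z)^n}{(tz+1)_n}\,\mathcal E_n(z),$$ where $(a+1)_n=(a+1)\cdots(a+n)$ for $n\ge0$ and $(a+1)_n=\bigl(a(a-1)\cdots(a+n+1)\bigr)^{-1}$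 for $n\le 0$. Define operators $\mathsf A^j_i$ ($j\ge0$, $i\in\mathbb Z$) by expanding matrix elements: $\mathsf A(z)=\sum_{j\ge0}t^j\sum_{i\in\mathbb Z}\mathsf A^j_i\,z^{i+1}$. The matrix of each $\mathsf A^j_i$ in the basis $(v_S)$ has finite rows, so $\mathsf A^j_i$ acts on the completion $\prod_S\mathbb C\,v_S$ and products of such operators are defined there. For an operator $X$ and a vector $w$ of the completion write $\langle X\mid w\rangle$ for the $v_\emptyset$-coordinate of $Xw$, and let $\langle X\rangle=\langle X\mid v_\emptyset\rangle$ be the vacuum expectation. Then for every $k\in\mathbb Z$ and every finite (possibly empty) product $D$ of operators $\mathsf A^0_i$ and $\mathsf A^1_i$, $i\in\mathbb Z$, in any order, $$\langle\mathsf A^1_k\,D\rangle=-\Bigl(\sum_{j=1}^{k}\frac1j\Bigr)\langle\mathsf A^0_{k-1}\,D\rangle+\frac12\sum_{i=0}^{k-3}\frac{(i+1)!\,(k-i-2)!}{k!}\,\langle\mathsf A^0_i\,\mathsf A^0_{k-i-3}\,D\rangle ,$$ where sums with upper limit below the lower limit are zero. More generally, the same identity holds with $\langle\,\cdot\mid w\rangle$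 in place of $\langle\,\cdot\,\rangle$, for every vector $w$ of the completion. -/

import Mathlib

open scoped Nat

namespace InfWedge

noncomputable section

/-! Half-integers are encoded by integers: `m : ℤ` stands for the half-integer `m + 1/2`.
So `m < 0` means that `m + 1/2` is a negative half-integer. -/

/-- The subsets `S` of the half-integers with `S₊` (positive elements of `S`) and `S₋` (negative
half-integers missing from `S`) finite. They index the basis `v_S` of the infinite wedge. -/
@[ext]
structure Config where
  carrier : Set ℤ
  finite_pos : {m : ℤ | 0 ≤ m ∧ m ∈ carrier}.Finite
  finite_neg : {m : ℤ | m < 0 ∧ m ∉ carrier}.Finite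

namespace Config

instance : Membership ℤ Config := ⟨fun S m => m ∈ S.carrier⟩

/-- `S ∪ {k}`. -/
def insert (S : Config) (k : ℤ) : Config where
  carrier := {m | m = k ∨ m ∈ S}
  finite_pos := by
    refine (S.finite_pos.union (Set.finite_singleton k)).subset ?_
    rintro m ⟨h0, rfl | hm⟩
    · exact Or.inr rfl
    · exact Or.inl ⟨h0, hm⟩
  finite_neg := by
    refine S.finite_neg.subset ?_
    rintro m ⟨h0, hm⟩
    exact ⟨h0, fun h => hm (Or.inr h)⟩

/-- `S \ {k}`. -/
def erase (S : Config) (k : ℤ) : Config where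
  carrier := {m | m ≠ k ∧ m ∈ S}
  finite_pos := by
    refine S.finite_pos.subset ?_
    rintro m ⟨h0, hm⟩
    exact ⟨h0, hm.2⟩
  finite_neg := by
    refine (S.finite_neg.union (Set.finite_singleton k)).subset ?_
    rintro m ⟨h0, hm⟩
    by_cases h : m = k
    · exact Or.inr h
    · exact Or.inl ⟨h0, fun h' => hm ⟨h, h'⟩⟩

/-- The configuration `{-1/2, -3/2, -5/2, …}` of the vacuum. -/
def vacuum : Config where
  carrier := {m | m < 0}
  finite_pos := by
    convert Set.finite_empty (α := ℤ)
    ext m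
    simp
  finite_neg := by
    convert Set.finite_empty (α := ℤ)
    ext m
    simp

/-- The number of elements of `S` that are larger than `k` (a finite number). -/
def above (S : Config) (k : ℤ) : ℕ := {m : ℤ | m ∈ S ∧ k < m}.ncard

theorem mem_insert {S : Config} {k m : ℤ} : m ∈ S.insert k ↔ m = k ∨ m ∈ S := Iff.rfl

theorem mem_erase {S : Config} {k m : ℤ} : m ∈ S.erase k ↔ m ≠ k ∧ m ∈ S := Iff.rfl

theorem ext_mem {S T : Config} (h : ∀ m : ℤ, m ∈ S ↔ m ∈ T) : S = T :=
  Config.ext (Set.ext h)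

theorem insert_erase {S : Config} {k : ℤ} (h : k ∈ S) : (S.erase k).insert k = S := by
  refine ext_mem fun m => ?_
  rw [mem_insert, mem_erase]
  by_cases hm : m = k
  · subst hm; simp [h]
  · simp [hm]

theorem erase_insert {S : Config} {k : ℤ} (h : k ∉ S) : (S.insert k).erase k = S := by
  refine ext_mem fun m => ?_
  rw [mem_erase, mem_insert]
  by_cases hm : m = k
  · subst hm; simp [h]
  · simp [hm]

theorem above_insert (S : Config) (k : ℤ) : (S.insert k).above k = S.above k := by
  unfold above
  congr 1
  ext m
  simp only [Set.mem_ofPred_eq, mem_insert]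
  constructor
  · rintro ⟨rfl | h, h'⟩
    · exact absurd h' (lt_irrefl _)
    · exact ⟨h, h'⟩
  · rintro ⟨h, h'⟩
    exact ⟨Or.inr h, h'⟩

theorem exists_upper (S : Config) : ∃ U : ℤ, ∀ m ∈ S, m < U := by
  obtain ⟨B, hB⟩ := S.finite_pos.bddAbove
  refine ⟨max 0 (B + 1), fun m hm => ?_⟩
  rcases lt_or_ge m 0 with h | h
  · exact lt_max_of_lt_left h
  · exact lt_max_of_lt_right (Int.lt_add_one_of_le (hB ⟨h, hm⟩))

theorem exists_lower (S : Config) : ∃ L : ℤ, ∀ m : ℤ, m ∉ S → L ≤ m := by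
  obtain ⟨B, hB⟩ := S.finite_neg.bddBelow
  refine ⟨min 0 B, fun m hm => ?_⟩
  rcases lt_or_ge m 0 with h | h
  · exact min_le_of_right_le (hB ⟨h, hm⟩)
  · exact min_le_of_left_le h

end Config

/-- The infinite wedge space with basis `v_S`. The coordinate of `x` at `S` is `(x, v_S)`. -/
abbrev Wedge : Type := Config →₀ ℂ

/-- The basis vector `v_S = s₁ ∧ s₂ ∧ s₃ ∧ ⋯`, where `s₁ > s₂ > s₃ > ⋯` are the elements of `S`. -/
def basisVec (S : Config) : Wedge := Finsupp.single S 1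

/-- Completion of the infinite wedge space: arbitrary families of coordinates. -/
abbrev Completion : Type := Config → ℂ

open scoped Classical in
/-- The fermionic operator `ψ_k`: wedge product with `k` from the left. -/
def psi (k : ℤ) : Module.End ℂ Wedge :=
  Finsupp.linearCombination ℂ fun S : Config =>
    if k ∈ S then 0 else (-1 : ℂ) ^ S.above k • basisVec (S.insert k)

open scoped Classical in
/-- The fermionic operator `ψ_k*`, the adjoint of `ψ_k` (see `psiStar_adjoint`). -/
def psiStar (k : ℤ) : Module.End ℂ Wedge :=
  Finsupp.linearCombination ℂ fun S : Config =>
    if k ∈ S then (-1 : ℂ) ^ S.above k • basisVec (S.erase k) else 0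

open scoped Classical in
theorem psi_basisVec (k : ℤ) (S : Config) : psi k (basisVec S) =
    if k ∈ S then 0 else (-1 : ℂ) ^ S.above k • basisVec (S.insert k) := by
  simp [psi, basisVec]

open scoped Classical in
theorem psiStar_basisVec (k : ℤ) (S : Config) : psiStar k (basisVec S) =
    if k ∈ S then (-1 : ℂ) ^ S.above k • basisVec (S.erase k) else 0 := by
  simp [psiStar, basisVec]

/-- `(ψ_k* v_T, v_S) = (v_T, ψ_k v_S)`. -/
theorem psiStar_adjoint (k : ℤ) (S T : Config) :
    psiStar k (basisVec T) S = psi k (basisVec S) T := by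
  classical
  rw [psi_basisVec, psiStar_basisVec]
  by_cases hT : k ∈ T <;> by_cases hS : k ∈ S
  · have h : T.erase k ≠ S := by
      rintro rfl
      exact (Config.mem_erase.1 hS).1 rfl
    simp [hT, hS, basisVec, h]
  · by_cases h : S.insert k = T
    · subst h
      simp [hT, hS, basisVec, Config.erase_insert hS, Config.above_insert]
    · have h' : T.erase k ≠ S := by
        rintro rfl
        exact h (Config.insert_erase hT)
      simp [hT, hS, basisVec, h, h']
  · simp [hT, hS]
  · have h : S.insert k ≠ T := by
      rintro rfl
      exact hT (Config.mem_insert.2 (Or.inl rfl))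
    simp [hT, hS, basisVec, h]

/-- The normally ordered product `:ψ_i ψ_j*:`, by which the matrix unit `E_{ij}` acts. -/
def matUnit (i j : ℤ) : Module.End ℂ Wedge :=
  if 0 ≤ j then psi i * psiStar j else -(psiStar j * psi i)

/-- The power series `e^{cz}` in `z`. -/
def expz (c : ℂ) : PowerSeries ℂ := PowerSeries.rescale c (PowerSeries.exp ℂ)

/-- `ς(z) = e^{z/2} - e^{-z/2}`. -/
def varsigma : PowerSeries ℂ := expz (1 / 2) - expz (-1 / 2)

/-- `𝒮(z) = ς(z) / z` (see `X_mul_calS`). -/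
def calS : PowerSeries ℂ := PowerSeries.mk fun n => PowerSeries.coeff (n + 1) varsigma

theorem X_mul_calS : PowerSeries.X * calS = varsigma := by
  ext n
  cases n with
  | zero =>
    have h : ∀ c : ℂ, PowerSeries.coeff 0 (expz c) = 1 := fun c => by
      rw [expz, PowerSeries.coeff_rescale]
      simp
    rw [varsigma, map_sub, h, h]
    simp
  | succ n => simp [calS, PowerSeries.coeff_succ_X_mul]

/-- Power series as Laurent series. -/
abbrev toLaurent : PowerSeries ℂ →+* LaurentSeries ℂ := HahnSeries.ofPowerSeries ℤ ℂ

open scoped Classical in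
/-- The matrix element `(𝓔_r(z) v_T, v_S)` of
`𝓔_r(z) = ∑_k e^{z(k - r/2)} E_{k-r,k} + δ_{r,0} / ς(z)`, as a Laurent series in `z`.
The half-integer `k` is encoded as `k = m + 1/2`; finitely many `m` contribute. -/
def calE (r : ℤ) (S T : Config) : LaurentSeries ℂ :=
  toLaurent (∑ᶠ m : ℤ,
    (matUnit (m - r) m (basisVec T) S) • expz ((m : ℂ) + 1 / 2 - (r : ℂ) / 2)) +
  if r = 0 ∧ S = T then (toLaurent varsigma)⁻¹ else 0

/-- `1 / (a+1)_n` as a power series in `a`, where `(a+1)_n = (a+1)(a+2)⋯(a+n)` for `n ≥ 0` and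
`(a+1)_n = (a(a-1)⋯(a+n+1))⁻¹` for `n ≤ 0`. -/
def pochInv (n : ℤ) : PowerSeries ℂ :=
  if 0 ≤ n then
    (∏ j ∈ Finset.range n.toNat, (PowerSeries.X + PowerSeries.C ((j : ℂ) + 1)))⁻¹
  else
    ∏ j ∈ Finset.range (-n).toNat, (PowerSeries.X - PowerSeries.C (j : ℂ))

/-- `𝒮(z)^a / (a+1)_n` as a power series in `a` over the power series in `z`, with
`𝒮(z)^a = exp(a ln 𝒮(z))`. -/
def prefactor (n : ℤ) : PowerSeries (PowerSeries ℂ) :=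
  PowerSeries.rescale (PowerSeries.logOf calS) (PowerSeries.exp (PowerSeries ℂ)) *
    PowerSeries.map PowerSeries.C (pochInv n)

/-- The matrix element `(A(a,z) v_T, v_S)` of
`A(a,z) = 𝒮(z)^a ∑_n ς(z)^n / (a+1)_n 𝓔_n(z)`, as a power series in `a` over the Laurent series
in `z`. At most one `n` contributes. -/
def twoParamA (S T : Config) : PowerSeries (LaurentSeries ℂ) :=
  ∑ᶠ n : ℤ, PowerSeries.map toLaurent (prefactor n) *
    PowerSeries.C (toLaurent varsigma ^ n * calE n S T)

/-- The matrix element `(A(z) v_T, v_S)` of `A(z) = A(tz, z)`, as a power series in `t` over the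
Laurent series in `z`. -/
def opA (S T : Config) : PowerSeries (LaurentSeries ℂ) :=
  PowerSeries.rescale (toLaurent PowerSeries.X) (twoParamA S T)

/-- The matrix element `(A^j_i v_T, v_S)`, where `A(z) = ∑_j t^j A^j(z)` and
`A^j(z) = ∑_i A^j_i z^{i+1}`. -/
def coeffA (j : ℕ) (i : ℤ) (S T : Config) : ℂ :=
  (PowerSeries.coeff j (opA S T)).coeff (i + 1)

/-! The matrix of `A^j_i` has finite rows (the adjoint of `A^j_i` preserves the infinite wedge
space), so that `A^j_i` acts on the completion and products of such operators make sense. -/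

theorem matUnit_ne_zero {i j : ℤ} (hij : i ≠ j) {S T : Config}
    (h : matUnit i j (basisVec T) S ≠ 0) :
    i ∈ S ∧ j ∉ S ∧ T = (S.erase i).insert j := by
  classical
  have key : j ∈ T ∧ i ∉ T ∧ S = (T.erase j).insert i := by
    unfold matUnit at h
    split_ifs at h with hj
    · rw [Module.End.mul_apply, psiStar_basisVec] at h
      split_ifs at h with h1
      · rw [map_smul, psi_basisVec] at h
        split_ifs at h with h2
        · simp at h
        · refine ⟨h1, fun h3 => h2 (Config.mem_erase.2 ⟨hij, h3⟩), ?_⟩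
          by_contra h4
          simp [basisVec, Ne.symm h4] at h
      · simp at h
    · rw [LinearMap.neg_apply, Module.End.mul_apply, psi_basisVec] at h
      split_ifs at h with h1
      · simp at h
      · rw [map_smul, psiStar_basisVec] at h
        split_ifs at h with h2
        · refine ⟨(Config.mem_insert.1 h2).resolve_left hij.symm, h1, ?_⟩
          have h3 : (T.insert i).erase j = (T.erase j).insert i := by
            refine Config.ext_mem fun m => ?_
            simp only [Config.mem_insert, Config.mem_erase]
            constructor
            · tauto
            · rintro (rfl | h')
              · exact ⟨hij, Or.inl rfl⟩
              · tauto
          rw [← h3]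
          by_contra h4
          simp [basisVec, Ne.symm h4] at h
        · simp at h
  obtain ⟨h1, h2, rfl⟩ := key
  refine ⟨Config.mem_insert.2 (Or.inl rfl), ?_, ?_⟩
  · rw [Config.mem_insert, Config.mem_erase]
    rintro (h | h)
    · exact hij h.symm
    · exact h.1 rfl
  · rw [Config.erase_insert fun h => h2 (Config.mem_erase.1 h).2, Config.insert_erase h1]

theorem matUnit_self_ne_zero {i : ℤ} {S T : Config} (h : matUnit i i (basisVec T) S ≠ 0) :
    T = S := by
  classical
  unfold matUnit at h
  split_ifs at h with hj
  · rw [Module.End.mul_apply, psiStar_basisVec] at h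
    split_ifs at h with h1
    · rw [map_smul, psi_basisVec] at h
      split_ifs at h with h2
      · simp at h
      · rw [Config.insert_erase h1] at h
        by_contra h4
        simp [basisVec, h4] at h
    · simp at h
  · rw [LinearMap.neg_apply, Module.End.mul_apply, psi_basisVec] at h
    split_ifs at h with h1
    · simp at h
    · rw [map_smul, psiStar_basisVec] at h
      split_ifs at h with h2
      · rw [Config.erase_insert h1] at h
        by_contra h4
        simp [basisVec, h4] at h
      · simp at h

theorem calE_ne_zero {r : ℤ} {S T : Config} (h : calE r S T ≠ 0) :
    T = S ∨ ∃ m : ℤ, m - r ∈ S ∧ m ∉ S ∧ T = (S.erase (m - r)).insert m := by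
  by_contra hc
  push Not at hc
  obtain ⟨h1, h2⟩ := hc
  apply h
  unfold calE
  rw [if_neg fun h' => h1 h'.2.symm, add_zero]
  have h3 : ∀ m : ℤ, matUnit (m - r) m (basisVec T) S = 0 := by
    intro m
    by_contra h4
    by_cases hr : m - r = m
    · rw [hr] at h4
      exact h1 (matUnit_self_ne_zero h4)
    · obtain ⟨ha, hb, hd⟩ := matUnit_ne_zero hr h4
      exact h2 m ha hb hd
  simp [h3]

theorem coeff_term_eq_zero {n i : ℤ} (hn : 0 < n) (hi : i + 1 < n) (j : ℕ) (S T : Config) :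
    (PowerSeries.coeff j (PowerSeries.rescale (toLaurent PowerSeries.X)
      (PowerSeries.map toLaurent (prefactor n) *
        PowerSeries.C (toLaurent varsigma ^ n * calE n S T)))).coeff (i + 1) = 0 := by
  lift n to ℕ using hn.le
  have h0 : (n : ℤ) ≠ 0 := hn.ne'
  have key : ∃ g : PowerSeries ℂ, PowerSeries.coeff j (PowerSeries.rescale
      (toLaurent PowerSeries.X) (PowerSeries.map toLaurent (prefactor n) *
        PowerSeries.C (toLaurent varsigma ^ (n : ℤ) * calE n S T))) =
      toLaurent (PowerSeries.X ^ n * g) := by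
    have hE : ∃ e : PowerSeries ℂ, calE n S T = toLaurent e := by
      unfold calE
      rw [if_neg fun h => h0 h.1, add_zero]
      exact ⟨_, rfl⟩
    obtain ⟨e, he⟩ := hE
    refine ⟨PowerSeries.X ^ j * (PowerSeries.coeff j (prefactor n) * (calS ^ n * e)), ?_⟩
    rw [PowerSeries.coeff_rescale, PowerSeries.coeff_mul_C, PowerSeries.coeff_map, he,
      zpow_natCast, ← X_mul_calS]
    simp only [map_mul, map_pow]
    ring
  obtain ⟨g, hg⟩ := key
  rw [hg, PowerSeries.coeff_coe]
  split_ifs with h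
  · rfl
  · rw [PowerSeries.coeff_X_pow_mul', if_neg]
    omega

theorem coeffA_finite (j : ℕ) (i : ℤ) (S : Config) : {T | coeffA j i S T ≠ 0}.Finite := by
  obtain ⟨U, hU⟩ := S.exists_upper
  obtain ⟨L, hL⟩ := S.exists_lower
  set N : ℤ := max 0 (i + 1) with hN
  refine (((((Set.finite_Icc (L - N) U).prod (Set.finite_Icc L (U + N))).image
    fun p : ℤ × ℤ => (S.erase p.1).insert p.2).union (Set.finite_singleton S))).subset ?_
  intro T hT
  have h1 : ∃ n : ℤ, (PowerSeries.coeff j (PowerSeries.rescale (toLaurent PowerSeries.X)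
      (PowerSeries.map toLaurent (prefactor n) *
        PowerSeries.C (toLaurent varsigma ^ n * calE n S T)))).coeff (i + 1) ≠ 0 := by
    by_contra hc
    push Not at hc
    apply hT
    unfold coeffA opA twoParamA
    by_cases hf : (Function.support fun n : ℤ => PowerSeries.map toLaurent (prefactor n) *
        PowerSeries.C (toLaurent varsigma ^ n * calE n S T)).Finite
    · rw [finsum_eq_sum _ hf, map_sum, map_sum, HahnSeries.coeff_sum]
      exact Finset.sum_eq_zero fun n _ => hc n
    · rw [finsum_of_infinite_support hf]
      simp
  obtain ⟨n, hn⟩ := h1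
  have hnN : n ≤ N := by
    by_contra hlt
    rw [hN, not_le, max_lt_iff] at hlt
    exact hn (coeff_term_eq_zero hlt.1 hlt.2 j S T)
  have hE : calE n S T ≠ 0 := by
    intro h
    rw [h] at hn
    simp at hn
  rcases calE_ne_zero hE with h | ⟨m, ha, hb, rfl⟩
  · exact Or.inr h
  · refine Or.inl ⟨(m - n, m), ?_, rfl⟩
    have h2 := hU _ ha
    have h3 := hL _ hb
    simp only [Set.mem_prod, Set.mem_Icc]
    omega

/-- The operator `A^j_i`, acting on the completion through its matrix. -/
def A (j : ℕ) (i : ℤ) : Module.End ℂ Completion where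
  toFun x := fun S => ∑ T ∈ (coeffA_finite j i S).toFinset, coeffA j i S T * x T
  map_add' x y := by
    ext S
    simp [mul_add, Finset.sum_add_distrib]
  map_smul' c x := by
    ext S
    simp [Finset.mul_sum, mul_left_comm]

/-- The vacuum vector `v_∅`. -/
def vac : Completion := fun S => basisVec Config.vacuum S

/-- The pairing `⟨X | w⟩ = (X w, v_∅)`. -/
def bracket (X : Module.End ℂ Completion) (w : Completion) : ℂ := X w Config.vacuum

/-- The vacuum expectation `⟨X⟩ = (X v_∅, v_∅)`. -/
def vev (X : Module.End ℂ Completion) : ℂ := bracket X vac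

/-- The product, from left to right, of the operators `A^ε_i` for `(ε, i)` in a list,
`ε ∈ {0, 1}`. -/
def word (L : List (Fin 2 × ℤ)) : Module.End ℂ Completion :=
  (L.map fun p => A (p.1 : ℕ) p.2).prod

end

end InfWedge

/-! Only the vacuum row of each operator matters: `D`, together with the vector it acts on, enters
as one arbitrary vector of the completion. The vacuum row is the transposed matrix applied to `v_∅`,
so of the one-body part only the matrix units moving some `a ≥ 0` to some `b < 0` (in the integer
encoding) survive, next to a scalar term. With `n = a - b > 0` the entry in `A^0(z)` is `E =
e^{z(b+1/2)} (e^z - 1)^n / n!`. In `A^1(z) / z` it is `E (ln 𝒮 - H_n)`, since the linear coefficient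
of `1 / (a+1)_n` at `a = 0` is `-H_n / n!`. The scalars are `1 / ς` and `ln 𝒮 / ς`.

The weights `p! q! / (p+q+1)!` are those of a convolution, so the formal Borel transform `z^n ↦ n!
X^n` turns the quadratic sum into `X` times an ordinary product. Linear differential equations for
`E` give `X^n ∏_{b ≤ j ≤ a} g_j` as its transform, with `g_j = 1 / (1 - (j + 1/2) X)`. Write `μ` for
the transform of `1 / ς - 1 / z`. Three facts carry the proof.

(1) For `b < 0 ≤ a` this transform is a function of `b` times a function of `a`. In the product of
two `A^0` on the vacuum the four-fermion terms therefore cancel by antisymmetry. The single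
contractions and the scalars multiply the transform of `E` by `∑_{0 ≤ j ≤ a} g_j - ∑_{b ≤ j < 0} g_j
+ 2 μ` (`sum_factorial_windowA`).

(2) Let `H` multiply the coefficient of `z^m` by `H_m`. The transform of `E ln 𝒮 + H E` is that of
`E` times `H_n + (X / 2)` times the same bracket (`borel_logHarm_elt`). The weight `H` produces the
term `-∑ 1/j` of the theorem.

(3) The scalar analogue is `ln 𝒮 / ς + H(1/ς - 1/z) = (1/2) (1/ς - 1/z) * (1/ς - 1/z)`, where `*` is
convolution (`harm_mu`).

Comparison gives `vacuum_relation`. It is stated for finite windows of matrix units, which compute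
the required finite rows exactly once the window is large (`eventually_rowVec_eq`). -/

namespace InfWedge

noncomputable section

open PowerSeries

/-! ### Formal Borel transform, convolution and harmonic weights -/

/-- The formal Borel–Laplace transform `z ^ n ↦ n! X ^ n`. -/
def borel : PowerSeries ℂ →ₗ[ℂ] PowerSeries ℂ where
  toFun f := mk fun n => (n ! : ℂ) * coeff n f
  map_add' f g := by ext n; simp [mul_add]
  map_smul' c f := by ext n; simp [mul_left_comm]

@[simp] theorem coeff_borel (n : ℕ) (f : PowerSeries ℂ) :
    coeff n (borel f) = (n ! : ℂ) * coeff n f := by simp [borel]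

theorem borel_injective : Function.Injective borel := fun f g h => by
  ext n
  have := congrArg (coeff n) h
  simpa [Nat.factorial_ne_zero] using this

/-- Integration by parts for the Laplace transform. Linear differential equations with constant
coefficients become algebraic equations in `X`. -/
theorem X_mul_borel_derivative (f : PowerSeries ℂ) :
    X * borel (d⁄dX ℂ f) = borel f - C (coeff 0 f) := by
  ext n
  cases n with
  | zero => rw [coeff_zero_X_mul]; simp [-coeff_zero_eq_constantCoeff]
  | succ n =>
    rw [coeff_succ_X_mul, coeff_borel, coeff_derivative, map_sub, coeff_borel, coeff_C,
      if_neg n.succ_ne_zero, Nat.factorial_succ]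
    push_cast
    ring

/-- The convolution `∫₀ᶻ f(y) g(z - y) dy`. -/
def conv (f g : PowerSeries ℂ) : PowerSeries ℂ :=
  mk fun n => coeff n (X * borel f * borel g) / (n ! : ℂ)

theorem borel_conv (f g : PowerSeries ℂ) : borel (conv f g) = X * borel f * borel g := by
  ext n
  rw [coeff_borel, conv, coeff_mk, mul_div_cancel₀]
  exact_mod_cast n.factorial_ne_zero

theorem conv_add_left (f f' g : PowerSeries ℂ) : conv (f + f') g = conv f g + conv f' g :=
  borel_injective (by simp only [borel_conv, map_add]; ring)

theorem conv_add_right (f g g' : PowerSeries ℂ) : conv f (g + g') = conv f g + conv f g' :=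
  borel_injective (by simp only [borel_conv, map_add]; ring)

theorem conv_comm (f g : PowerSeries ℂ) : conv f g = conv g f :=
  borel_injective (by simp only [borel_conv]; ring)

theorem coeff_zero_conv (f g : PowerSeries ℂ) : coeff 0 (conv f g) = 0 := by
  rw [conv, coeff_mk, mul_assoc]
  simp

theorem derivative_conv (f g : PowerSeries ℂ) :
    d⁄dX ℂ (conv f g) = conv (d⁄dX ℂ f) g + coeff 0 f • g := by
  apply borel_injective
  apply mul_left_cancel₀ (X_ne_zero (R := ℂ))
  rw [X_mul_borel_derivative, coeff_zero_conv, map_add, borel_conv, borel_conv, map_smul,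
    X_mul_borel_derivative, smul_eq_C_mul]
  simp only [map_zero]
  ring

/-- Multiplication of the coefficient of `z ^ n` by the harmonic number `H_n`. -/
def harm : PowerSeries ℂ →ₗ[ℂ] PowerSeries ℂ where
  toFun f := mk fun n => ((harmonic n : ℚ) : ℂ) * coeff n f
  map_add' f g := by ext n; simp [mul_add]
  map_smul' c f := by ext n; simp [mul_left_comm]

@[simp] theorem coeff_harm (n : ℕ) (f : PowerSeries ℂ) :
    coeff n (harm f) = ((harmonic n : ℚ) : ℂ) * coeff n f := by simp [harm]

/-- The difference quotient `(f - f(0)) / z`. -/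
def shift (f : PowerSeries ℂ) : PowerSeries ℂ := mk fun n => coeff (n + 1) f

theorem X_mul_shift (f : PowerSeries ℂ) : X * shift f = f - C (coeff 0 f) := by
  ext n
  cases n with
  | zero => simp
  | succ n => simp [shift, coeff_succ_X_mul]

/-- The difference `H_{n+1} - H_n = 1 / (n+1)` cancels the factor `n + 1` produced by
differentiation. -/
theorem derivative_harm (f : PowerSeries ℂ) :
    d⁄dX ℂ (harm f) = harm (d⁄dX ℂ f) + shift f := by
  ext n
  simp only [coeff_derivative, coeff_harm, map_add, shift, coeff_mk, harmonic_succ]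
  have : (n : ℂ) + 1 ≠ 0 := by exact_mod_cast n.succ_ne_zero
  push_cast
  field_simp

/-! ### Exponentials, `ς` and `𝒮` -/

theorem coeff_zero_expz (c : ℂ) : coeff 0 (expz c) = 1 := by
  rw [expz, coeff_rescale]; simp

theorem derivative_expz (c : ℂ) : d⁄dX ℂ (expz c) = c • expz c := by
  ext n
  rw [coeff_derivative, expz, coeff_rescale, coeff_smul, coeff_rescale, coeff_exp, coeff_exp]
  simp only [one_div, map_inv₀, map_natCast, Nat.factorial_succ, smul_eq_mul]
  have : (n : ℂ) + 1 ≠ 0 := by exact_mod_cast n.succ_ne_zero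
  have : (n ! : ℂ) ≠ 0 := by exact_mod_cast n.factorial_ne_zero
  push_cast
  field_simp
  ring

theorem expz_add (c d : ℂ) : expz (c + d) = expz c * expz d :=
  (exp_mul_exp_eq_exp_add c d).symm

theorem expz_zero : expz 0 = 1 := by
  rw [expz, rescale_zero_apply]; simp

theorem derivative_varsigma :
    d⁄dX ℂ varsigma = (1 / 2 : ℂ) • (expz (1 / 2) + expz (-1 / 2)) := by
  rw [varsigma, map_sub, derivative_expz, derivative_expz, ← sub_eq_zero]
  module

theorem constantCoeff_calS : constantCoeff calS = 1 := by
  rw [← coeff_zero_eq_constantCoeff_apply, calS, coeff_mk]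
  have := congrArg (coeff 0) derivative_varsigma
  rw [coeff_derivative, coeff_smul, map_add, coeff_zero_expz, coeff_zero_expz] at this
  simpa using this.trans (by norm_num)

theorem calS_ne_zero : calS ≠ 0 := fun h => by
  simpa [h] using constantCoeff_calS

theorem varsigma_ne_zero : varsigma ≠ 0 := by
  rw [← X_mul_calS]
  exact mul_ne_zero X_ne_zero calS_ne_zero

/-- `ln 𝒮(z)`. -/
def logS : PowerSeries ℂ := logOf calS

theorem coeff_zero_logS : coeff 0 logS = 0 := by
  rw [coeff_zero_eq_constantCoeff_apply]
  exact constantCoeff_logOf constantCoeff_calS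

theorem mul_derivative_logOf {f : PowerSeries ℂ} (hf : constantCoeff f = 1) :
    f * d⁄dX ℂ (logOf f) = d⁄dX ℂ f := by
  have hs : HasSubst (f - 1) := HasSubst.of_constantCoeff_zero' (by simp [hf])
  have h1 : (1 + X) * d⁄dX ℂ (log ℂ) = 1 := by
    rw [deriv_log]
    ext n
    cases n with
    | zero => simp [add_mul]
    | succ n => simp [add_mul, coeff_succ_X_mul, coeff_one, pow_succ]
  have h2 := congrArg (subst (f - 1)) h1
  rw [← coe_substAlgHom hs, map_mul, map_add, map_one, coe_substAlgHom hs, subst_X hs,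
    add_sub_cancel] at h2
  rw [logOf_eq, derivative_subst hs, ← mul_assoc, h2, one_mul, map_sub]
  simp

theorem varsigma_mul_derivative_logS :
    varsigma * d⁄dX ℂ logS = d⁄dX ℂ varsigma - calS := by
  rw [← X_mul_calS, mul_assoc, logS, mul_derivative_logOf constantCoeff_calS, Derivation.leibniz]
  simp only [derivative_X, smul_eq_mul]
  ring

/-- `1 / ς(z) - 1 / z`. -/
def mu : PowerSeries ℂ := shift calS⁻¹

theorem X_mul_mu : X * mu = calS⁻¹ - 1 := by
  rw [mu, X_mul_shift, coeff_zero_eq_constantCoeff_apply, constantCoeff_inv, constantCoeff_calS]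
  simp

theorem calS_mul_inv : calS * calS⁻¹ = 1 :=
  PowerSeries.mul_inv_cancel _ (by rw [constantCoeff_calS]; exact one_ne_zero)

theorem varsigma_mul_mu : varsigma * mu = 1 - calS := by
  rw [← X_mul_calS, mul_comm X, mul_assoc, X_mul_mu, mul_sub, calS_mul_inv, mul_one]

/-! ### The operation `g ↦ g ln 𝒮 + H g` -/

/-- `g(z) ln 𝒮(z)` plus the harmonic weights. -/
def logHarm : PowerSeries ℂ →ₗ[ℂ] PowerSeries ℂ := LinearMap.mulRight ℂ logS + harm

theorem logHarm_apply (g : PowerSeries ℂ) : logHarm g = g * logS + harm g := rfl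

theorem coeff_zero_logHarm (g : PowerSeries ℂ) : coeff 0 (logHarm g) = 0 := by
  have := coeff_zero_logS
  simp only [coeff_zero_eq_constantCoeff] at this
  simp [logHarm_apply, harm, -coeff_zero_eq_constantCoeff]
  simp [this]

/-- The defect of `logHarm` to commute with the derivative, multiplied by `ς`. -/
theorem varsigma_mul_derivative_logHarm (g : PowerSeries ℂ) :
    varsigma * (d⁄dX ℂ (logHarm g) - logHarm (d⁄dX ℂ g)) =
      g * d⁄dX ℂ varsigma - C (coeff 0 g) * calS := by
  have h1 := varsigma_mul_derivative_logS
  have h2 : varsigma * shift g = calS * (g - C (coeff 0 g)) := by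
    rw [← X_mul_calS, mul_comm X, mul_assoc, X_mul_shift]
  rw [logHarm_apply, logHarm_apply, map_add, Derivation.leibniz, derivative_harm]
  simp only [smul_eq_mul]
  linear_combination g * h1 + h2

theorem X_mul_borel_derivative_logHarm (g : PowerSeries ℂ) :
    X * borel (d⁄dX ℂ (logHarm g)) = borel (logHarm g) := by
  rw [X_mul_borel_derivative, coeff_zero_logHarm, map_zero, sub_zero]

/-! ### The matrix elements of `𝖠⁰` -/

/-- `e^{z(b + 1/2)} (e^z - 1)^n / n!`, the coefficient in `A^0(z)` of the matrix unit that moves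
`b + n` to `b`. -/
def elt (b : ℤ) (n : ℕ) : PowerSeries ℂ :=
  (1 / (n ! : ℂ)) • (expz ((b : ℂ) + 1 / 2) * (expz 1 - 1) ^ n)

theorem elt_succ_left (b : ℤ) (n : ℕ) : elt (b + 1) n = expz 1 * elt b n := by
  rw [elt, elt, mul_smul_comm, ← mul_assoc, ← expz_add]
  rw [show (((b + 1 : ℤ) : ℂ) + 1 / 2) = 1 + ((b : ℂ) + 1 / 2) by push_cast; ring]

theorem expz_sub_one_mul_elt (b : ℤ) (n : ℕ) :
    (expz 1 - 1) * elt b n = ((n : ℂ) + 1) • elt b (n + 1) := by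
  rw [elt, elt, mul_smul_comm, smul_smul, pow_succ]
  have : (n : ℂ) + 1 ≠ 0 := by exact_mod_cast n.succ_ne_zero
  have : (n ! : ℂ) ≠ 0 := by exact_mod_cast n.factorial_ne_zero
  congr 1
  · rw [Nat.factorial_succ]
    push_cast
    field_simp
  · ring

theorem elt_succ_left' (b : ℤ) (n : ℕ) :
    elt (b + 1) n = ((n : ℂ) + 1) • elt b (n + 1) + elt b n := by
  rw [← expz_sub_one_mul_elt, elt_succ_left]
  ring

theorem derivative_elt_zero (b : ℤ) : d⁄dX ℂ (elt b 0) = ((b : ℂ) + 1 / 2) • elt b 0 := by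
  simp [elt, derivative_expz]

theorem derivative_elt_succ (b : ℤ) (n : ℕ) :
    d⁄dX ℂ (elt b (n + 1)) = ((b : ℂ) + 1 / 2) • elt b (n + 1) + elt (b + 1) n := by
  have : (n : ℂ) + 1 ≠ 0 := by exact_mod_cast n.succ_ne_zero
  have : (n ! : ℂ) ≠ 0 := by exact_mod_cast n.factorial_ne_zero
  have h : ((n + 1)! : ℂ)⁻¹ * ((n : ℂ) + 1) = (n ! : ℂ)⁻¹ := by
    rw [Nat.factorial_succ]
    push_cast
    field_simp
  rw [elt_succ_left, elt, elt]
  simp only [Derivation.map_smul, Derivation.leibniz, derivative_pow, derivative_expz, map_sub, one_div,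
    Derivation.map_one_eq_zero, sub_zero, one_smul, smul_eq_mul, ← h, add_tsub_cancel_right]
  simp only [smul_eq_C_mul, map_mul, map_add, map_natCast, map_one]
  push_cast
  ring

theorem coeff_zero_elt_succ (b : ℤ) (n : ℕ) : coeff 0 (elt b (n + 1)) = 0 := by
  have h := coeff_zero_expz 1
  simp only [coeff_zero_eq_constantCoeff] at h
  simp [elt, h]

theorem coeff_zero_elt_zero (b : ℤ) : coeff 0 (elt b 0) = 1 := by
  simpa [elt] using coeff_zero_expz ((b : ℂ) + 1 / 2)

/-- `1 / (1 - (b + 1/2) X)`. -/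
def geom (b : ℤ) : PowerSeries ℂ := (1 - C ((b : ℂ) + 1 / 2) * X)⁻¹

theorem mul_geom (b : ℤ) : (1 - C ((b : ℂ) + 1 / 2) * X) * geom b = 1 :=
  PowerSeries.mul_inv_cancel _ (by simp)

theorem eq_geom_mul {b : ℤ} {f g : PowerSeries ℂ}
    (h : (1 - C ((b : ℂ) + 1 / 2) * X) * f = g) : f = geom b * g := by
  rw [← h, ← mul_assoc, mul_comm (geom b), mul_geom, one_mul]

theorem borel_elt_zero (b : ℤ) : borel (elt b 0) = geom b := by
  have h := X_mul_borel_derivative (elt b 0)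
  rw [derivative_elt_zero, coeff_zero_elt_zero, map_smul, smul_eq_C_mul] at h
  rw [← mul_one (geom b)]
  apply eq_geom_mul
  rw [map_one] at h
  linear_combination -h

theorem borel_elt_succ (b : ℤ) (n : ℕ) :
    borel (elt b (n + 1)) = geom b * (X * borel (elt (b + 1) n)) := by
  have h := X_mul_borel_derivative (elt b (n + 1))
  rw [derivative_elt_succ, coeff_zero_elt_succ, map_add, map_smul, smul_eq_C_mul] at h
  apply eq_geom_mul
  rw [map_zero] at h
  linear_combination -h

/-- The interval `[b, b + n + 1]` loses its upper end here and its lower end in `borel_elt_succ`;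
the two recursions come from the two ways of writing the derivative. -/
theorem borel_elt_succ' (b : ℤ) (n : ℕ) :
    borel (elt b (n + 1)) = geom (b + (n + 1 : ℕ)) * (X * borel (elt b n)) := by
  have h := X_mul_borel_derivative (elt b (n + 1))
  rw [derivative_elt_succ, elt_succ_left', coeff_zero_elt_succ, map_add, map_add, map_smul,
    map_smul, smul_eq_C_mul, smul_eq_C_mul] at h
  apply eq_geom_mul
  simp only [map_zero, map_add, map_one, map_natCast, Int.cast_add, Int.cast_natCast] at h ⊢
  push_cast
  linear_combination -h

/-! ### `logHarm` of the matrix elements -/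

/-- Since the entry has no constant term, the commutator is multiplication by `ς' / ς = (1/2) (e^z +
1) / (e^z - 1)`. The denominator cancels one factor `e^z - 1`, and the numerator leaves two
neighbouring entries. -/
theorem derivative_logHarm_elt_succ (b : ℤ) (n : ℕ) :
    d⁄dX ℂ (logHarm (elt b (n + 1))) = logHarm (d⁄dX ℂ (elt b (n + 1))) +
      (1 / (2 * ((n : ℂ) + 1))) • (elt b n + elt (b + 1) n) := by
  rw [← sub_eq_iff_eq_add']
  apply mul_left_cancel₀ varsigma_ne_zero
  have hn : (n : ℂ) + 1 ≠ 0 := by exact_mod_cast n.succ_ne_zero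
  have h1 : elt b (n + 1) = ((n : ℂ) + 1)⁻¹ • ((expz 1 - 1) * elt b n) := by
    rw [expz_sub_one_mul_elt, smul_smul, inv_mul_cancel₀ hn, one_smul]
  have h2 : varsigma = expz (-1 / 2) * (expz 1 - 1) := by
    rw [varsigma, mul_sub, ← expz_add]; norm_num
  have h3 : d⁄dX ℂ varsigma = (1 / 2 : ℂ) • (expz (-1 / 2) * (expz 1 + 1)) := by
    rw [derivative_varsigma, mul_add, ← expz_add]; norm_num
  have h4 : (1 / (2 * ((n : ℂ) + 1))) = ((n : ℂ) + 1)⁻¹ * (1 / 2) := by field_simp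
  rw [varsigma_mul_derivative_logHarm, coeff_zero_elt_succ, elt_succ_left, h3, h1, h2, h4,
    mul_smul]
  simp only [map_zero, smul_eq_C_mul]
  ring

/-- Here the constant term is `1` and the correction by `𝒮` removes the pole of `e^{z/2} ς' / ς`;
its regular part brings in `mu`. -/
theorem derivative_logHarm_elt_zero :
    d⁄dX ℂ (logHarm (elt 0 0)) =
      logHarm (d⁄dX ℂ (elt 0 0)) + ((1 / 2 : ℂ) • elt 0 0 + mu) := by
  rw [← sub_eq_iff_eq_add']
  apply mul_left_cancel₀ varsigma_ne_zero
  have h : elt 0 0 = expz (1 / 2) := by simp [elt]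
  have h2 : expz (1 / 2) * expz (-1 / 2) = 1 := by
    rw [← expz_add]; norm_num [expz_zero]
  rw [varsigma_mul_derivative_logHarm, coeff_zero_elt_zero, h, derivative_varsigma, mul_add,
    varsigma_mul_mu, varsigma]
  have h3 : C (R := ℂ) (1 / 2) * 2 = 1 := by
    rw [← map_ofNat C 2, ← map_mul]; norm_num
  simp only [map_one, smul_eq_C_mul]
  linear_combination 2 * C (1 / 2 : ℂ) * h2 + h3

theorem borel_logHarm_elt_zero :
    borel (logHarm (elt 0 0)) =
      borel (elt 0 0) * (X * (C (1 / 2) * geom 0 + borel mu)) := by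
  have h := X_mul_borel_derivative_logHarm (elt 0 0)
  rw [derivative_logHarm_elt_zero, derivative_elt_zero, map_smul, map_add, map_add, map_smul,
    map_smul, smul_eq_C_mul, smul_eq_C_mul] at h
  rw [borel_elt_zero] at h ⊢
  apply eq_geom_mul
  linear_combination -h

theorem borel_logHarm_elt_succ' (b : ℤ) (n : ℕ) (q : PowerSeries ℂ)
    (h : borel (logHarm (elt b n)) = borel (elt b n) * q) :
    borel (logHarm (elt b (n + 1))) = borel (elt b (n + 1)) *
      (q + C ((n : ℂ) + 1)⁻¹ + X * (C (1 / 2) * geom (b + (n + 1 : ℕ)))) := by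
  have hn : (n : ℂ) + 1 ≠ 0 := by exact_mod_cast n.succ_ne_zero
  have h1 := X_mul_borel_derivative_logHarm (elt b (n + 1))
  rw [derivative_logHarm_elt_succ, derivative_elt_succ, elt_succ_left'] at h1
  -- With `elt (b + 1) n` eliminated, `elt b n` feeds the harmonic increment `1 / (n+1)`, and the
  -- unknown's own entry gives the new `geom` term.
  have h2 : (1 / (2 * ((n : ℂ) + 1))) • (elt b n + (((n : ℂ) + 1) • elt b (n + 1) + elt b n)) =
      ((n : ℂ) + 1)⁻¹ • elt b n + (1 / 2 : ℂ) • elt b (n + 1) := by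
    have : (1 / (2 * ((n : ℂ) + 1))) * ((n : ℂ) + 1) = 1 / 2 := by field_simp
    rw [smul_add, smul_add, smul_smul, this]
    have : ((n : ℂ) + 1)⁻¹ = 2 * (1 / (2 * ((n : ℂ) + 1))) := by field_simp
    rw [this]
    module
  rw [h2] at h1
  simp only [map_add, map_smul, h] at h1
  simp only [smul_eq_C_mul] at h1
  have h3 := borel_elt_succ' b n
  have h4 := mul_geom (b + (n + 1 : ℕ))
  have key : (1 - C (((b + (n + 1 : ℕ) : ℤ) : ℂ) + 1 / 2) * X) *
      borel (logHarm (elt b (n + 1))) = X * (borel (elt b n) * (q + C ((n : ℂ) + 1)⁻¹) +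
        C (1 / 2) * borel (elt b (n + 1))) := by
    push_cast
    simp only [map_add, map_natCast, map_one, map_intCast] at h1 ⊢
    linear_combination -h1
  rw [eq_geom_mul key]
  linear_combination (-q - C ((n : ℂ) + 1)⁻¹) * h3

/-- The mirror image of `borel_logHarm_elt_succ'`: eliminating `elt b n` instead reverses the sign
of the `geom` term. -/
theorem borel_logHarm_elt_succ (b : ℤ) (n : ℕ) (q : PowerSeries ℂ)
    (h : borel (logHarm (elt (b + 1) n)) = borel (elt (b + 1) n) * q) :
    borel (logHarm (elt b (n + 1))) = borel (elt b (n + 1)) *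
      (q + C ((n : ℂ) + 1)⁻¹ - X * (C (1 / 2) * geom b)) := by
  have hn : (n : ℂ) + 1 ≠ 0 := by exact_mod_cast n.succ_ne_zero
  have h1 := X_mul_borel_derivative_logHarm (elt b (n + 1))
  rw [derivative_logHarm_elt_succ, derivative_elt_succ,
    eq_sub_of_add_eq' (elt_succ_left' b n).symm] at h1
  have h2 : (1 / (2 * ((n : ℂ) + 1))) •
      (elt (b + 1) n - ((n : ℂ) + 1) • elt b (n + 1) + elt (b + 1) n) =
      ((n : ℂ) + 1)⁻¹ • elt (b + 1) n - (1 / 2 : ℂ) • elt b (n + 1) := by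
    have : (1 / (2 * ((n : ℂ) + 1))) * ((n : ℂ) + 1) = 1 / 2 := by field_simp
    rw [smul_add, smul_sub, smul_smul, this]
    have : ((n : ℂ) + 1)⁻¹ = 2 * (1 / (2 * ((n : ℂ) + 1))) := by field_simp
    rw [this]
    module
  rw [h2] at h1
  simp only [map_add, map_sub, map_smul, h] at h1
  simp only [smul_eq_C_mul] at h1
  have h3 := borel_elt_succ b n
  have key : (1 - C ((b : ℂ) + 1 / 2) * X) *
      borel (logHarm (elt b (n + 1))) = X * (borel (elt (b + 1) n) * (q + C ((n : ℂ) + 1)⁻¹) -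
        C (1 / 2) * borel (elt b (n + 1))) := by
    simp only [map_add] at h1 ⊢
    linear_combination -h1
  rw [eq_geom_mul key]
  linear_combination (-q - C ((n : ℂ) + 1)⁻¹) * h3

/-- The interval grows from `{0}`, where `mu` enters. Each step up adds `(X/2) geom`, each step down
subtracts it, and both extend the harmonic number. -/
theorem borel_logHarm_elt (m n : ℕ) :
    borel (logHarm (elt (-(m : ℤ)) (n + m))) = borel (elt (-(m : ℤ)) (n + m)) *
      (C ((harmonic (n + m) : ℚ) : ℂ) + X * (C (1 / 2) * ∑ j ∈ Finset.range (n + 1), geom j -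
        C (1 / 2) * ∑ j ∈ Finset.range m, geom (-((j : ℤ) + 1)) + borel mu)) := by
  induction m with
  | zero =>
    induction n with
    | zero => simpa using borel_logHarm_elt_zero
    | succ n ih =>
      have := borel_logHarm_elt_succ' _ _ _ ih
      simp only [Nat.cast_zero, neg_zero, add_zero, zero_add] at this ⊢
      rw [this, Finset.sum_range_succ _ (n + 1), harmonic_succ]
      push_cast
      rw [map_add]
      ring
  | succ m ih =>
    have e : (-((m + 1 : ℕ) : ℤ)) + 1 = -(m : ℤ) := by push_cast; ring
    rw [← e] at ih
    have := borel_logHarm_elt_succ _ _ _ ih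
    rw [← add_assoc, this, Finset.sum_range_succ _ m, harmonic_succ]
    push_cast
    rw [map_add]
    ring

/-! ### The vacuum coefficient -/

/-- Uniqueness principle for identities involving multiplication by `e^z`: the relation lowers the
order of a coefficient at the price of changing `g`, so the induction runs over all `g` at once. -/
theorem ext_of_derivative_eq {V : PowerSeries ℂ → PowerSeries ℂ}
    (h0 : ∀ g, coeff 0 (V g) = 0) (h : ∀ g, d⁄dX ℂ (V g) = V g + V (d⁄dX ℂ g))
    (g : PowerSeries ℂ) : V g = 0 := by
  suffices ∀ n g, coeff n (V g) = 0 by ext n; simpa using this n g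
  intro n
  induction n with
  | zero => exact h0
  | succ n ih =>
    intro g
    have := congrArg (coeff n) (h g)
    rw [coeff_derivative, map_add, ih, ih, add_zero] at this
    exact (mul_eq_zero.1 this).resolve_right (by exact_mod_cast n.succ_ne_zero)

/-- `(e^z - 1) / z`. -/
def expDiv : PowerSeries ℂ := shift (expz 1)

theorem X_mul_expDiv : X * expDiv = expz 1 - 1 := by
  rw [expDiv, X_mul_shift, coeff_zero_expz, map_one]

/-- Formal version of `e^z = e^y e^{z-y}` under the convolution integral. -/
theorem expz_mul_conv (f g : PowerSeries ℂ) :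
    expz 1 * conv f g = conv (expz 1 * f) (expz 1 * g) := by
  rw [← sub_eq_zero]
  have hE : d⁄dX ℂ (expz 1) = expz 1 := by rw [derivative_expz, one_smul]
  refine ext_of_derivative_eq (V := fun f => expz 1 * conv f g - conv (expz 1 * f) (expz 1 * g))
    (fun f => ?_) (fun f => ?_) f
  · have := coeff_zero_conv
    simp only [coeff_zero_eq_constantCoeff] at this
    simp [this]
  · have h := coeff_zero_expz 1
    simp only [coeff_zero_eq_constantCoeff] at h
    simp only [map_sub, Derivation.leibniz, derivative_conv, hE, smul_eq_mul, conv_add_left,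
      coeff_zero_eq_constantCoeff, map_mul, h, smul_eq_C_mul, one_mul]
    rw [mul_comm f (expz 1)]
    ring

theorem harm_expz_mul (g : PowerSeries ℂ) :
    harm (expz 1 * g) = expz 1 * harm g + conv (expz 1 * g) expDiv := by
  rw [← sub_eq_zero]
  have hE : d⁄dX ℂ (expz 1) = expz 1 := by rw [derivative_expz, one_smul]
  refine ext_of_derivative_eq
    (V := fun g => harm (expz 1 * g) - (expz 1 * harm g + conv (expz 1 * g) expDiv))
    (fun f => ?_) (fun f => ?_) g
  · have := coeff_zero_conv
    have h2 : ∀ f, coeff 0 (harm f) = 0 := fun f => by rw [coeff_harm]; simp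
    simp only [coeff_zero_eq_constantCoeff] at this h2
    simp [this, h2]
  · have h := coeff_zero_expz 1
    have h3 : shift (expz 1 * f) = expz 1 * shift f + coeff 0 f • expDiv := by
      apply mul_left_cancel₀ (X_ne_zero (R := ℂ))
      rw [X_mul_shift, mul_add, mul_left_comm, X_mul_shift, mul_smul_comm, X_mul_expDiv,
        smul_eq_C_mul]
      simp only [coeff_zero_eq_constantCoeff] at h ⊢
      simp only [map_mul, h]
      simp only [map_one]
      ring
    simp only [map_sub, map_add, Derivation.leibniz, derivative_conv, derivative_harm, hE,
      smul_eq_mul, conv_add_left, h3]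
    simp only [coeff_zero_eq_constantCoeff] at h ⊢
    simp only [map_mul, h, one_mul, mul_comm f (expz 1)]
    ring

/-- The Borel transform of `expDiv` is `-ln(1 - X) / X`, and its square generates harmonic numbers
by the partial fraction `1/((p+1)(q+1)) = (1/(p+1) + 1/(q+1)) / (p+q+2)`. -/
theorem harm_expDiv : harm expDiv = (1 / 2 : ℂ) • conv expDiv expDiv := by
  have hc : ∀ n, coeff n expDiv = 1 / ((n + 1)! : ℂ) := fun n => by
    rw [expDiv, shift, coeff_mk, expz, coeff_rescale, coeff_exp]
    simp
  have hb : ∀ n, coeff n (borel expDiv) = 1 / ((n : ℂ) + 1) := fun n => by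
    have : (n ! : ℂ) ≠ 0 := by exact_mod_cast n.factorial_ne_zero
    have : (n : ℂ) + 1 ≠ 0 := by exact_mod_cast n.succ_ne_zero
    rw [coeff_borel, hc, Nat.factorial_succ]
    push_cast
    field_simp
  apply borel_injective
  rw [map_smul, borel_conv, mul_assoc]
  ext n
  cases n with
  | zero => simp
  | succ n =>
    rw [coeff_smul, coeff_succ_X_mul, coeff_borel, coeff_harm, coeff_mul, hc]
    have h1 : ∀ p ∈ Finset.HasAntidiagonal.antidiagonal n, coeff p.1 (borel expDiv) * coeff p.2 (borel expDiv) =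
        1 / ((n : ℂ) + 2) * (1 / ((p.1 : ℂ) + 1) + 1 / ((p.2 : ℂ) + 1)) := by
      rintro ⟨p, q⟩ hp
      rw [Finset.HasAntidiagonal.mem_antidiagonal] at hp
      have h1 : (p : ℂ) + 1 ≠ 0 := by exact_mod_cast p.succ_ne_zero
      have h2 : (q : ℂ) + 1 ≠ 0 := by exact_mod_cast q.succ_ne_zero
      have h3 : (n : ℂ) + 2 = (p + 1) + (q + 1) := by
        rw [← hp]; push_cast; ring
      have h4 : (p + 1 : ℂ) + (q + 1) ≠ 0 := by
        rw [← h3]; exact_mod_cast (Nat.succ_ne_zero (n + 1))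
      rw [hb, hb, h3]
      field_simp
      ring
    have h2 : ∑ p ∈ Finset.HasAntidiagonal.antidiagonal n, (1 / ((p.1 : ℂ) + 1)) =
        ((harmonic (n + 1) : ℚ) : ℂ) := by
      rw [Finset.Nat.sum_antidiagonal_eq_sum_range_succ_mk, harmonic]
      push_cast
      simp
    have h3 : ∑ p ∈ Finset.HasAntidiagonal.antidiagonal n, (1 / ((p.2 : ℂ) + 1)) =
        ((harmonic (n + 1) : ℚ) : ℂ) := by
      rw [← h2, ← Finset.Nat.sum_antidiagonal_swap]
      rfl
    rw [Finset.sum_congr rfl h1, ← Finset.mul_sum, Finset.sum_add_distrib, h2, h3,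
      Nat.factorial_succ (n + 1)]
    have : ((n + 1)! : ℂ) ≠ 0 := by exact_mod_cast (n + 1).factorial_ne_zero
    have : (n : ℂ) + 2 ≠ 0 := by exact_mod_cast (Nat.succ_ne_zero (n + 1))
    have : (n : ℂ) + 1 + 1 ≠ 0 := by rw [add_assoc]; norm_num; assumption
    push_cast
    simp only [smul_eq_mul]
    field_simp
    ring

/-- `ln 𝒮(z) / ς(z)`. -/
def logSDiv : PowerSeries ℂ := shift logS * calS⁻¹

theorem varsigma_mul_logSDiv : varsigma * logSDiv = logS := by
  rw [logSDiv, ← X_mul_calS]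
  have := X_mul_shift logS
  rw [coeff_zero_logS, map_zero, sub_zero] at this
  linear_combination (X * shift logS) * calS_mul_inv + this

/-- The regular form of `e^z / ς = 1 / ς + e^{z/2}`, with the polar part `1 / z` removed on both
sides. -/
theorem expz_mul_mu : expz 1 * mu + expDiv = mu + elt 0 0 := by
  apply mul_left_cancel₀ varsigma_ne_zero
  have h : elt 0 0 = expz (1 / 2) := by simp [elt]
  have h1 : varsigma * expz (1 / 2) = expz 1 - 1 := by
    rw [varsigma, sub_mul, ← expz_add, ← expz_add]; norm_num [expz_zero]
  have h2 : varsigma * expDiv = calS * (expz 1 - 1) := by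
    rw [← X_mul_expDiv, ← X_mul_calS]; ring
  rw [h]
  linear_combination (expz 1 - 1) * varsigma_mul_mu + h2 - h1

/-- The defect `U` is shown to be invariant under multiplication by `e^z`, which forces it to
vanish. The two expressions for `μ'` in `expz_mul_mu` evaluate the same quantity as `e^z U` and as
`U`. -/
theorem harm_mu : logSDiv + harm mu = (1 / 2 : ℂ) • conv mu mu := by
  rw [← sub_eq_zero]
  set U := logSDiv + harm mu - (1 / 2 : ℂ) • conv mu mu with hU
  set μ' := expz 1 * mu + expDiv with hμ
  have h1 : expz 1 * logSDiv + harm μ' - (1 / 2 : ℂ) • conv μ' μ' = expz 1 * U := by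
    rw [hU, hμ, map_add, harm_expz_mul, harm_expDiv]
    simp only [conv_add_left, conv_add_right, ← expz_mul_conv, conv_comm expDiv (expz 1 * mu)]
    simp only [mul_sub, mul_add, mul_smul_comm]
    module
  have h2 : expz 1 * logSDiv + harm μ' - (1 / 2 : ℂ) • conv μ' μ' = U := by
    -- This convolution identity supplies exactly the linear and quadratic terms created by adding
    -- `e^{z/2}` to `mu`.
    have h3 : logHarm (elt 0 0) = conv (elt 0 0) ((1 / 2 : ℂ) • elt 0 0 + mu) := by
      apply borel_injective
      rw [borel_logHarm_elt_zero, borel_conv, map_add, map_smul, borel_elt_zero, smul_eq_C_mul]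
      ring
    have h4 : expz 1 * logSDiv = logSDiv + elt 0 0 * logS := by
      have h : elt 0 0 = expz (1 / 2) := by simp [elt]
      have h1 : varsigma * expz (1 / 2) = expz 1 - 1 := by
        rw [varsigma, sub_mul, ← expz_add, ← expz_add]; norm_num [expz_zero]
      apply mul_left_cancel₀ varsigma_ne_zero
      rw [h]
      linear_combination (expz 1 - 1) * varsigma_mul_logSDiv - logS * h1
    rw [logHarm_apply] at h3
    have h5 : conv (elt 0 0) ((1 / 2 : ℂ) • elt 0 0 + mu) =
        (1 / 2 : ℂ) • conv (elt 0 0) (elt 0 0) + conv (elt 0 0) mu := by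
      apply borel_injective
      simp only [borel_conv, map_add, map_smul]
      simp only [smul_eq_C_mul]
      ring
    rw [h5] at h3
    rw [hμ, expz_mul_mu, h4, map_add, hU, eq_sub_of_add_eq' h3]
    simp only [conv_add_left, conv_add_right, conv_comm mu (elt 0 0)]
    module
  have h3 : (expz 1 - 1) * U = 0 := by
    rw [sub_mul, ← h1, h2]; ring
  refine (mul_eq_zero.1 h3).resolve_left fun h => ?_
  have := congrArg (coeff 1) h
  simp [expz, coeff_one] at this

/-- The Borel transform of the relation between `ln 𝒮 / ς` and the coefficients of `1 / ς`. -/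
theorem borel_logSDiv : borel (logSDiv + harm mu) = C (1 / 2) * (X * (borel mu * borel mu)) := by
  rw [harm_mu, map_smul, borel_conv, smul_eq_C_mul, mul_assoc]

/-! ### Canonical anticommutation relations -/

namespace Config

theorem finite_above (S : Config) (k : ℤ) : {m : ℤ | m ∈ S ∧ k < m}.Finite := by
  obtain ⟨U, hU⟩ := S.exists_upper
  exact (Set.finite_Ioo k U).subset fun m hm => ⟨hm.2, hU m hm.1⟩

theorem above_insert_of_lt {S : Config} {k m : ℤ} (hk : k ∉ S) (h : m < k) :
    (S.insert k).above m = S.above m + 1 := by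
  unfold above
  rw [← Set.ncard_insert_of_notMem (a := k) (fun h => hk h.1) (S.finite_above m)]
  congr 1
  ext x
  simp only [Set.mem_ofPred_eq, mem_insert, Set.mem_insert_iff]
  constructor
  · tauto
  · rintro (rfl | h')
    · exact ⟨Or.inl rfl, h⟩
    · tauto

theorem above_insert_of_gt {S : Config} {k m : ℤ} (h : k < m) :
    (S.insert k).above m = S.above m := by
  unfold above
  congr 1
  ext x
  simp only [Set.mem_ofPred_eq, mem_insert]
  constructor
  · rintro ⟨rfl | h', h''⟩
    · exact absurd h'' h.le.not_gt
    · exact ⟨h', h''⟩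
  · tauto

theorem sign_insert {S : Config} {k m : ℤ} (hk : k ∉ S) (hm : m ≠ k) :
    (-1 : ℂ) ^ (S.insert k).above m = (if m < k then -1 else 1) * (-1) ^ S.above m := by
  split_ifs with h
  · rw [above_insert_of_lt hk h, pow_succ]; ring
  · rw [above_insert_of_gt (lt_of_le_of_ne (not_lt.1 h) hm.symm), one_mul]

theorem sign_erase {S : Config} {k m : ℤ} (hk : k ∈ S) (hm : m ≠ k) :
    (-1 : ℂ) ^ (S.erase k).above m = (if m < k then -1 else 1) * (-1) ^ S.above m := by
  have h := sign_insert (S := S.erase k) (fun h => (mem_erase.1 h).1 rfl) hm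
  rw [insert_erase hk] at h
  rw [h, ← mul_assoc]
  split_ifs <;> norm_num

theorem insert_comm (S : Config) (a b : ℤ) : (S.insert a).insert b = (S.insert b).insert a :=
  ext_mem fun m => by simp only [mem_insert]; tauto

theorem erase_comm (S : Config) (a b : ℤ) : (S.erase a).erase b = (S.erase b).erase a :=
  ext_mem fun m => by simp only [mem_erase]; tauto

theorem erase_insert_comm (S : Config) {a b : ℤ} (h : a ≠ b) :
    (S.insert a).erase b = (S.erase b).insert a :=
  ext_mem fun m => by
    simp only [mem_erase, mem_insert]
    constructor
    · tauto
    · rintro (rfl | h')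
      · exact ⟨h, Or.inl rfl⟩
      · tauto

end Config

theorem wedge_hom_ext {f g : Module.End ℂ Wedge} (h : ∀ S, f (basisVec S) = g (basisVec S)) :
    f = g :=
  Finsupp.lhom_ext' fun S => LinearMap.ext_ring (h S)

theorem sign_lt_mul {a b : ℤ} (h : a ≠ b) :
    (if a < b then -1 else 1 : ℂ) * (if b < a then -1 else 1) = -1 := by
  rcases lt_or_gt_of_ne h with h | h
  · rw [if_pos h, if_neg h.le.not_gt]; norm_num
  · rw [if_neg h.le.not_gt, if_pos h]; norm_num

theorem psi_mul_psi (a b : ℤ) : psi a * psi b = -(psi b * psi a) := by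
  classical
  refine wedge_hom_ext fun S => ?_
  rw [LinearMap.neg_apply, Module.End.mul_apply, Module.End.mul_apply, psi_basisVec, psi_basisVec]
  by_cases hab : a = b
  · subst hab
    split_ifs with h
    · simp
    · simp [psi_basisVec, Config.mem_insert]
  · by_cases ha : a ∈ S
    · by_cases hb : b ∈ S <;> simp [psi_basisVec, ha, hb, Config.mem_insert]
    · by_cases hb : b ∈ S
      · simp [psi_basisVec, ha, hb, Config.mem_insert]
      · simp only [ha, hb, if_false, map_smul, psi_basisVec, Config.mem_insert, hab, Ne.symm hab,
          or_self, smul_smul, Config.sign_insert hb hab, Config.sign_insert ha (Ne.symm hab),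
          Config.insert_comm S b a, ← neg_smul]
        congr 1
        have := sign_lt_mul hab
        split_ifs at this ⊢ <;> first | ring1 | norm_num at this

theorem psiStar_mul_psiStar (a b : ℤ) : psiStar a * psiStar b = -(psiStar b * psiStar a) := by
  classical
  refine wedge_hom_ext fun S => ?_
  rw [LinearMap.neg_apply, Module.End.mul_apply, Module.End.mul_apply, psiStar_basisVec,
    psiStar_basisVec]
  by_cases hab : a = b
  · subst hab
    split_ifs with h
    · simp [psiStar_basisVec, Config.mem_erase]
    · simp
  · by_cases ha : a ∈ S
    · by_cases hb : b ∈ S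
      · simp only [ha, hb, if_true, map_smul, psiStar_basisVec, Config.mem_erase, hab,
          Ne.symm hab, ne_eq, not_false_eq_true, and_self, smul_smul, Config.sign_erase hb hab,
          Config.sign_erase ha (Ne.symm hab), Config.erase_comm S b a, ← neg_smul]
        congr 1
        have := sign_lt_mul hab
        split_ifs at this ⊢ <;> first | ring1 | norm_num at this
      · simp [psiStar_basisVec, ha, hb, Config.mem_erase]
    · by_cases hb : b ∈ S <;> simp [psiStar_basisVec, ha, hb, Config.mem_erase]

theorem psi_mul_psiStar (a b : ℤ) :
    psi a * psiStar b = (if a = b then 1 else 0) - psiStar b * psi a := by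
  classical
  refine wedge_hom_ext fun S => ?_
  rw [LinearMap.sub_apply, Module.End.mul_apply, Module.End.mul_apply, psiStar_basisVec,
    psi_basisVec]
  have hsq : ∀ n : ℕ, (-1 : ℂ) ^ n * (-1) ^ n = 1 := fun n => by
    rw [← mul_pow]; norm_num
  by_cases hab : a = b
  · subst hab
    by_cases h : a ∈ S
    · have h1 := Config.above_insert (S.erase a) a
      rw [Config.insert_erase h] at h1
      simp [h, psi_basisVec, Config.mem_erase, smul_smul, ← h1, hsq, Config.insert_erase h]
    · simp [h, psiStar_basisVec, Config.mem_insert, smul_smul, Config.above_insert, hsq,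
        Config.erase_insert h]
  · by_cases ha : a ∈ S
    · by_cases hb : b ∈ S <;>
        simp [psi_basisVec, ha, hb, hab, Config.mem_erase]
    · by_cases hb : b ∈ S
      · simp only [ha, hb, if_false, if_true, map_smul, psiStar_basisVec, psi_basisVec,
          Config.mem_insert, Config.mem_erase, hab, Ne.symm hab, false_or, and_false, smul_smul,
          Config.sign_insert ha (Ne.symm hab), Config.sign_erase hb hab,
          Config.erase_insert_comm S hab, LinearMap.zero_apply, zero_sub, ← neg_smul]
        congr 1
        have := sign_lt_mul hab
        split_ifs at this ⊢ <;> first | ring1 | norm_num at this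
      · simp [psiStar_basisVec, ha, hb, hab, Ne.symm hab, Config.mem_insert]

theorem psi_psi (a b : ℤ) (x : Wedge) : psi a (psi b x) = -psi b (psi a x) :=
  LinearMap.congr_fun (psi_mul_psi a b) x

theorem psiStar_psiStar (a b : ℤ) (x : Wedge) : psiStar a (psiStar b x) = -psiStar b (psiStar a x) :=
  LinearMap.congr_fun (psiStar_mul_psiStar a b) x

theorem psi_psiStar (a b : ℤ) (x : Wedge) :
    psi a (psiStar b x) = (if a = b then x else 0) - psiStar b (psi a x) := by
  have := LinearMap.congr_fun (psi_mul_psiStar a b) x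
  rw [Module.End.mul_apply] at this
  rw [this]
  split_ifs <;> simp

theorem matUnit_apply (a b : ℤ) (x : Wedge) :
    matUnit a b x = if 0 ≤ b then psi a (psiStar b x) else -psiStar b (psi a x) := by
  unfold matUnit
  split_ifs <;> rfl

/-- Normal ordering changes a matrix unit only by a scalar, so the commutator with a fermion is that
of the one-body operator for either sign of `b`. -/
theorem matUnit_psi (a b c : ℤ) (x : Wedge) :
    matUnit a b (psi c x) = psi c (matUnit a b x) + if b = c then psi a x else 0 := by
  have h1 : psiStar b (psi c x) = (if b = c then x else 0) - psi c (psiStar b x) := by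
    rw [psi_psiStar]; simp [eq_comm]
  have h2 : psiStar b (psi c (psi a x)) =
      (if b = c then psi a x else 0) - psi c (psiStar b (psi a x)) := by
    rw [psi_psiStar]; simp [eq_comm]
  rw [matUnit_apply, matUnit_apply]
  split_ifs at h1 h2 ⊢
  · rw [h1, map_sub, psi_psi a c]; abel
  · rw [h1, map_sub, psi_psi a c]; simp
  · rw [psi_psi a c, map_neg, map_neg, h2]; abel
  · rw [psi_psi a c, map_neg, map_neg, h2]; abel

theorem matUnit_psiStar (a b d : ℤ) (x : Wedge) :
    matUnit a b (psiStar d x) = psiStar d (matUnit a b x) - if a = d then psiStar b x else 0 := by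
  have h1 := psi_psiStar a d x
  have h2 := psi_psiStar a d (psiStar b x)
  rw [matUnit_apply, matUnit_apply]
  split_ifs at h1 h2 ⊢
  · rw [psiStar_psiStar b d, map_neg, h2]; abel
  · rw [psiStar_psiStar b d, map_neg, h2]; abel
  · rw [h1, map_sub, psiStar_psiStar b d, map_neg]; abel
  · rw [h1, map_sub, psiStar_psiStar b d, map_neg]; simp

/-- The vacuum vector in the infinite wedge space. -/
def vacVec : Wedge := basisVec Config.vacuum

theorem mem_vacuum {m : ℤ} : m ∈ Config.vacuum ↔ m < 0 := Iff.rfl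

theorem psi_vacVec {a : ℤ} (h : a < 0) : psi a vacVec = 0 := by
  rw [vacVec, psi_basisVec, if_pos (mem_vacuum.2 h)]

theorem psiStar_vacVec {b : ℤ} (h : 0 ≤ b) : psiStar b vacVec = 0 := by
  rw [vacVec, psiStar_basisVec, if_neg (mem_vacuum.not.2 h.not_gt)]

/-- `ψ_c ψ_d* v_∅`. -/
def hookVec (c d : ℤ) : Wedge := psi c (psiStar d vacVec)

theorem matUnit_vacVec (a b : ℤ) :
    matUnit a b vacVec = if 0 ≤ a ∧ b < 0 then hookVec a b else 0 := by
  rw [matUnit_apply]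
  rcases lt_or_ge b 0 with hb | hb
  · rw [if_neg hb.not_ge]
    rcases lt_or_ge a 0 with ha | ha
    · rw [if_neg fun h => ha.not_ge h.1, psi_vacVec ha, map_zero, neg_zero]
    · rw [if_pos ⟨ha, hb⟩, hookVec, psi_psiStar, if_neg (hb.trans_le ha).ne', zero_sub]
  · rw [if_pos hb, if_neg fun h => h.2.not_ge hb, psiStar_vacVec hb, map_zero]

theorem matUnit_hookVec (a b c d : ℤ) :
    matUnit a b (hookVec c d) =
      psi c (psiStar d (matUnit a b vacVec)) - (if a = d then hookVec c b else 0) +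
        if b = c then hookVec a d else 0 := by
  unfold hookVec
  rw [matUnit_psi, matUnit_psiStar, map_sub]
  congr 2
  split_ifs <;> simp

/-- The antisymmetry behind the cancellation of the four-fermion terms. -/
theorem psi_psiStar_hookVec {a b c d : ℤ} (ha : 0 ≤ a) (hc : 0 ≤ c) (hd : d < 0) :
    psi c (psiStar d (hookVec a b)) = -psi a (psiStar d (hookVec c b)) := by
  have h : ∀ {a d : ℤ} {x : Wedge}, 0 ≤ a → d < 0 →
      psiStar d (psi a x) = -psi a (psiStar d x) := fun {a d x} ha hd => by
    rw [psi_psiStar, if_neg (hd.trans_le ha).ne', zero_sub, neg_neg]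
  rw [hookVec, hookVec, h ha hd, h hc hd, map_neg, map_neg, psi_psi]

/-! ### Products of the Borel transforms of the matrix elements -/

/-- The coefficient in `A^0(z)` of the matrix unit that moves `a` to `b`. -/
def entry (b a : ℤ) : PowerSeries ℂ := if b ≤ a then elt b (a - b).toNat else 0

theorem entry_of_lt {a b : ℤ} (h : a < b) : entry b a = 0 := if_neg h.not_ge

theorem entry_hook (c d : ℕ) :
    entry (-((d : ℤ) + 1)) c = elt (-((d + 1 : ℕ) : ℤ)) (c + (d + 1)) := by
  rw [entry, if_pos (by omega)]
  congr 1

theorem entry_nat {c a : ℕ} (h : c ≤ a) : entry (c : ℤ) a = elt c (a - c) := by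
  rw [entry, if_pos (by omega)]
  congr 1
  omega

theorem entry_neg {b d : ℕ} (h : d ≤ b) :
    entry (-((b : ℤ) + 1)) (-((d : ℤ) + 1)) = elt (-((b : ℤ) + 1)) (b - d) := by
  rw [entry, if_pos (by omega)]
  congr 1
  omega

/-- The factor of `borel (elt _ _)` that depends on the upper end only. -/
def upper (n : ℕ) : PowerSeries ℂ := ∏ j ∈ Finset.range n, X * geom (((j + 1 : ℕ) : ℤ))

/-- The factor of `borel (elt _ _)` that depends on the lower end only. -/
def lower (m : ℕ) : PowerSeries ℂ := ∏ j ∈ Finset.range m, X * geom (-((j : ℤ) + 1))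

theorem upper_succ (n : ℕ) : upper (n + 1) = upper n * (X * geom (((n + 1 : ℕ) : ℤ))) :=
  Finset.prod_range_succ _ n

theorem lower_succ (m : ℕ) : lower (m + 1) = lower m * (X * geom (-((m : ℤ) + 1))) :=
  Finset.prod_range_succ _ m

/-- For intervals containing `0` the two ends separate. This rank-one form makes the product of two
hook entries symmetric under exchange of their upper ends. -/
theorem borel_elt_eq (m n : ℕ) :
    borel (elt (-(m : ℤ)) (n + m)) = lower m * geom 0 * upper n := by
  induction m with
  | zero =>
    induction n with
    | zero => simp [upper, lower, borel_elt_zero]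
    | succ n ih =>
      simp only [Nat.cast_zero, neg_zero, add_zero] at ih ⊢
      rw [borel_elt_succ', ih, upper_succ, zero_add]
      ring
  | succ m ih =>
    have e : -((m + 1 : ℕ) : ℤ) + 1 = -(m : ℤ) := by push_cast; ring
    rw [← add_assoc, borel_elt_succ, e, ih, lower_succ]
    push_cast
    ring

theorem upper_mul_borel_elt (c n : ℕ) :
    upper c * borel (elt c n) = upper (c + n) * geom c := by
  induction n with
  | zero => rw [borel_elt_zero, add_zero]
  | succ n ih =>
    rw [borel_elt_succ', ← add_assoc, upper_succ]
    push_cast at ih ⊢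
    rw [← add_assoc]
    linear_combination X * geom (c + n + 1) * ih

theorem lower_mul_borel_elt (d n : ℕ) :
    lower (d + 1) * borel (elt (-(((d + n : ℕ) : ℤ) + 1)) n) =
      lower (d + n + 1) * geom (-((d : ℤ) + 1)) := by
  induction n with
  | zero => rw [borel_elt_zero, add_zero]
  | succ n ih =>
    have e : -(((d + (n + 1) : ℕ) : ℤ) + 1) + 1 = -(((d + n : ℕ) : ℤ) + 1) := by push_cast; ring
    rw [borel_elt_succ, e, ← add_assoc d n 1, lower_succ (d + n + 1)]
    linear_combination X * geom (-(((d + n + 1 : ℕ) : ℤ) + 1)) * ih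

theorem borel_entry_hook (c d : ℕ) :
    borel (entry (-((d : ℤ) + 1)) c) = lower (d + 1) * geom 0 * upper c := by
  rw [entry_hook, borel_elt_eq]

/-- Splitting the interval at `c` counts the factor `geom c` twice, so every `c` between `0` and `a`
reproduces the whole entry times `geom c`. -/
theorem sum_borel_entry_mul_nat {N a : ℕ} (ha : a < N) (d : ℕ) :
    ∑ c ∈ Finset.range N, borel (entry (-((d : ℤ) + 1)) c) * borel (entry c a) =
      borel (entry (-((d : ℤ) + 1)) a) * ∑ c ∈ Finset.range (a + 1), geom c := by
  rw [Finset.mul_sum]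
  symm
  refine Finset.sum_subset_zero_on_sdiff (Finset.range_mono ha) (fun c hc => ?_) fun c hc => ?_
  · rw [Finset.mem_sdiff, Finset.mem_range, Finset.mem_range] at hc
    rw [entry_of_lt (b := (c : ℤ)) (by omega), map_zero, mul_zero]
  · have hca : c ≤ a := Nat.lt_succ_iff.1 (Finset.mem_range.1 hc)
    have h := upper_mul_borel_elt c (a - c)
    rw [Nat.add_sub_cancel' hca] at h
    rw [borel_entry_hook, borel_entry_hook, entry_nat hca]
    linear_combination -lower (d + 1) * geom 0 * h

theorem sum_borel_entry_mul_neg {N b : ℕ} (hb : b < N) (c : ℕ) :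
    ∑ d ∈ Finset.range N, borel (entry (-((d : ℤ) + 1)) c) *
        borel (entry (-((b : ℤ) + 1)) (-((d : ℤ) + 1))) =
      borel (entry (-((b : ℤ) + 1)) c) * ∑ d ∈ Finset.range (b + 1), geom (-((d : ℤ) + 1)) := by
  rw [Finset.mul_sum]
  symm
  refine Finset.sum_subset_zero_on_sdiff (Finset.range_mono hb) (fun d hd => ?_) fun d hd => ?_
  · rw [Finset.mem_sdiff, Finset.mem_range, Finset.mem_range] at hd
    rw [entry_of_lt (a := -((d : ℤ) + 1)) (by omega), map_zero, mul_zero]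
  · have hdb : d ≤ b := Nat.lt_succ_iff.1 (Finset.mem_range.1 hd)
    have h := lower_mul_borel_elt d (b - d)
    rw [Nat.add_sub_cancel' hdb] at h
    rw [borel_entry_hook, borel_entry_hook, entry_neg hdb]
    linear_combination -upper c * geom 0 * h

/-! ### One-body operators cut off to a finite window -/

theorem sum_Ico_neg {M : Type*} [AddCommMonoid M] (N : ℕ) (f : ℤ → M) :
    ∑ a ∈ Finset.Ico (-(N : ℤ)) N, f a =
      ∑ j ∈ Finset.range N, f j + ∑ j ∈ Finset.range N, f (-((j : ℤ) + 1)) := by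
  induction N with
  | zero => simp
  | succ N ih =>
    have h : Finset.Ico (-((N + 1 : ℕ) : ℤ)) (N + 1 : ℕ) =
        insert (N : ℤ) (insert (-((N : ℤ) + 1)) (Finset.Ico (-(N : ℤ)) N)) := by
      ext x
      simp only [Finset.mem_Ico, Finset.mem_insert]
      omega
    rw [h, Finset.sum_insert, Finset.sum_insert, ih, Finset.sum_range_succ, Finset.sum_range_succ]
    · abel
    · simp
    · simp only [Finset.mem_Ico, Finset.mem_insert]
      omega

/-- The operator `∑ g b a :ψ_a ψ_b*: + κ` with `a` and `b` in `[-N, N)`. -/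
def window (N : ℕ) (g : ℤ → ℤ → ℂ) (κ : ℂ) : Module.End ℂ Wedge :=
  ∑ a ∈ Finset.Ico (-(N : ℤ)) N, ∑ b ∈ Finset.Ico (-(N : ℤ)) N, g b a • matUnit a b + κ • 1

theorem window_apply (N : ℕ) (g : ℤ → ℤ → ℂ) (κ : ℂ) (x : Wedge) :
    window N g κ x = ∑ a ∈ Finset.Ico (-(N : ℤ)) N, ∑ b ∈ Finset.Ico (-(N : ℤ)) N,
      g b a • matUnit a b x + κ • x := by
  simp [window, LinearMap.sum_apply]

/-- The vector `ψ_c ψ_d* v_∅`, where `d` is encoded by the natural number `-d - 1`. -/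
def natHook (c d : ℕ) : Wedge := hookVec c (-((d : ℤ) + 1))

theorem sum_window_vacVec (N : ℕ) (g : ℤ → ℤ → ℂ) :
    ∑ a ∈ Finset.Ico (-(N : ℤ)) N, ∑ b ∈ Finset.Ico (-(N : ℤ)) N, g b a • matUnit a b vacVec =
      ∑ c ∈ Finset.range N, ∑ d ∈ Finset.range N, g (-((d : ℤ) + 1)) c • natHook c d := by
  have h1 : ∀ j : ℕ, ¬(0 ≤ -((j : ℤ) + 1)) := fun j => by omega
  have h2 : ∀ j : ℕ, -((j : ℤ) + 1) < 0 := fun j => by omega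
  simp only [sum_Ico_neg, matUnit_vacVec, h1, h2, false_and, if_false, smul_zero,
    Finset.sum_const_zero, add_zero, and_true, Nat.cast_nonneg, true_and, if_true, natHook]
  refine Finset.sum_congr rfl fun c _ => ?_
  rw [Finset.sum_eq_zero, zero_add]
  intro d _
  rw [if_neg (by omega), smul_zero]

theorem window_vacVec (N : ℕ) (g : ℤ → ℤ → ℂ) (κ : ℂ) :
    window N g κ vacVec = ∑ c ∈ Finset.range N, ∑ d ∈ Finset.range N,
      g (-((d : ℤ) + 1)) c • natHook c d + κ • vacVec := by
  rw [window_apply, sum_window_vacVec]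

/-- The four terms are: the particle moves, the hole moves, a second hook is created, and the scalar
acts. Triangularity of `g` keeps particles at nonnegative and holes at negative positions. -/
theorem window_natHook {N c d : ℕ} (hc : c < N) (hd : d < N) (g : ℤ → ℤ → ℂ) (κ : ℂ)
    (hg : ∀ b a, a < b → g b a = 0) :
    window N g κ (natHook c d) =
      ∑ a ∈ Finset.range N, g c a • natHook a d -
        ∑ b ∈ Finset.range N, g (-((b : ℤ) + 1)) (-((d : ℤ) + 1)) • natHook c b +
        ∑ a ∈ Finset.range N, ∑ b ∈ Finset.range N, g (-((b : ℤ) + 1)) a •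
          psi c (psiStar (-((d : ℤ) + 1)) (natHook a b)) + κ • natHook c d := by
  rw [window_apply]
  congr 1
  have hc' : (c : ℤ) ∈ Finset.Ico (-(N : ℤ)) N := by rw [Finset.mem_Ico]; omega
  have hd' : -((d : ℤ) + 1) ∈ Finset.Ico (-(N : ℤ)) N := by rw [Finset.mem_Ico]; omega
  have h1 : ∀ a b : ℤ, g b a • matUnit a b (natHook c d) =
      (if b = c then g b a • hookVec a (-((d : ℤ) + 1)) else 0) -
        (if a = -((d : ℤ) + 1) then g b a • hookVec c b else 0) +
        psi c (psiStar (-((d : ℤ) + 1)) (g b a • matUnit a b vacVec)) := fun a b => by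
    rw [natHook, matUnit_hookVec, map_smul, map_smul]
    split_ifs <;> simp only [smul_add, smul_sub, smul_zero] <;> abel
  simp only [h1, Finset.sum_add_distrib, Finset.sum_sub_distrib]
  congr 1
  · congr 1
    · simp only [Finset.sum_ite_eq', hc', if_true]
      rw [sum_Ico_neg, Finset.sum_eq_zero (f := fun j : ℕ => g c (-((j : ℤ) + 1)) • _), add_zero]
      · rfl
      · intro j _
        rw [hg _ _ (by omega), zero_smul]
    · rw [Finset.sum_comm]
      simp only [Finset.sum_ite_eq', hd', if_true]
      rw [sum_Ico_neg, Finset.sum_eq_zero (f := fun j : ℕ => g j (-((d : ℤ) + 1)) • _), zero_add]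
      · rfl
      · intro j _
        rw [hg _ _ (by omega), zero_smul]
  · simp only [← map_sum, sum_window_vacVec]
    simp only [map_sum, map_smul]

/-- The operator `[z^p] A^0(z)`, cut off to a finite window, without the polar part of `1 / ς`. -/
def windowA (N p : ℕ) : Module.End ℂ Wedge :=
  window N (fun b a => coeff p (entry b a)) (coeff p mu)

theorem factorial_smul_windowA (N p : ℕ) :
    (p ! : ℂ) • windowA N p =
      window N (fun b a => coeff p (borel (entry b a))) (coeff p (borel mu)) := by
  refine LinearMap.ext fun x => ?_
  rw [LinearMap.smul_apply, windowA, window_apply, window_apply]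
  simp only [smul_add, Finset.smul_sum, smul_smul, coeff_borel]

theorem sum_eq_zero_of_antisymm (N : ℕ) (F : ℕ → ℕ → ℕ → ℕ → Wedge)
    (h : ∀ c d a b, F c d a b = -F a d c b) :
    ∑ c ∈ Finset.range N, ∑ d ∈ Finset.range N, ∑ a ∈ Finset.range N, ∑ b ∈ Finset.range N,
      F c d a b = 0 := by
  rw [Finset.sum_comm]
  refine Finset.sum_eq_zero fun d _ => ?_
  rw [← self_eq_neg]
  -- Exchanging the summation variables `c` and `a` turns the sum into its negative.
  conv_rhs => rw [Finset.sum_comm]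
  simp only [← Finset.sum_neg_distrib]
  exact Finset.sum_congr rfl fun c _ => Finset.sum_congr rfl fun a _ =>
    Finset.sum_congr rfl fun b _ => h c d a b

theorem sum_factorial_windowA (N n : ℕ) :
    ∑ p ∈ Finset.HasAntidiagonal.antidiagonal n,
        ((p.1 ! : ℂ) * (p.2 ! : ℂ)) • windowA N p.2 (windowA N p.1 vacVec) =
      ∑ c ∈ Finset.range N, ∑ d ∈ Finset.range N,
        coeff n (borel (entry (-((d : ℤ) + 1)) c) * (∑ j ∈ Finset.range (c + 1), geom j -
          ∑ j ∈ Finset.range (d + 1), geom (-((j : ℤ) + 1)) + 2 * borel mu)) • natHook c d +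
        coeff n (borel mu * borel mu) • vacVec := by
  -- Factorials are absorbed into Borel transforms. The summation over the antidiagonal will turn
  -- each product of coefficients into a coefficient of a product.
  have key : ∀ p ∈ Finset.HasAntidiagonal.antidiagonal n,
      ((p.1 ! : ℂ) * (p.2 ! : ℂ)) • windowA N p.2 (windowA N p.1 vacVec) =
      ∑ d ∈ Finset.range N, ∑ a ∈ Finset.range N, ∑ c ∈ Finset.range N,
        (coeff p.1 (borel (entry (-((d : ℤ) + 1)) c)) * coeff p.2 (borel (entry c a))) •
          natHook a d -
      ∑ c ∈ Finset.range N, ∑ b ∈ Finset.range N, ∑ d ∈ Finset.range N,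
        (coeff p.1 (borel (entry (-((d : ℤ) + 1)) c)) *
          coeff p.2 (borel (entry (-((b : ℤ) + 1)) (-((d : ℤ) + 1))))) • natHook c b +
      ∑ c ∈ Finset.range N, ∑ d ∈ Finset.range N, ∑ a ∈ Finset.range N, ∑ b ∈ Finset.range N,
        (coeff p.1 (borel (entry (-((d : ℤ) + 1)) c)) *
          coeff p.2 (borel (entry (-((b : ℤ) + 1)) a))) •
            psi c (psiStar (-((d : ℤ) + 1)) (natHook a b)) +
      ∑ c ∈ Finset.range N, ∑ d ∈ Finset.range N,
        (coeff p.1 (borel (entry (-((d : ℤ) + 1)) c)) * coeff p.2 (borel mu)) • natHook c d +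
      ∑ c ∈ Finset.range N, ∑ d ∈ Finset.range N,
        (coeff p.1 (borel mu) * coeff p.2 (borel (entry (-((d : ℤ) + 1)) c))) • natHook c d +
      (coeff p.1 (borel mu) * coeff p.2 (borel mu)) • vacVec := by
    rintro ⟨p, q⟩ -
    have h1 : ((p ! : ℂ) * (q ! : ℂ)) • windowA N q (windowA N p vacVec) =
        ((q ! : ℂ) • windowA N q) (((p ! : ℂ) • windowA N p) vacVec) := by
      simp only [LinearMap.smul_apply, map_smul, smul_smul]
    have h2 : ∀ c ∈ Finset.range N, ∀ d ∈ Finset.range N, _ := fun c hc d hd =>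
      window_natHook (Finset.mem_range.1 hc) (Finset.mem_range.1 hd)
        (fun b a => coeff q (borel (entry b a))) (coeff q (borel mu)) fun b a hab => by
          rw [entry_of_lt hab, map_zero, map_zero]
    simp only [h1, factorial_smul_windowA]
    rw [window_vacVec, map_add, map_sum, map_smul, window_vacVec]
    have h3 : ∀ c ∈ Finset.range N, ∑ d ∈ Finset.range N,
        coeff p (borel (entry (-((d : ℤ) + 1)) c)) •
          window N (fun b a => coeff q (borel (entry b a))) (coeff q (borel mu)) (natHook c d) =
        ∑ d ∈ Finset.range N, coeff p (borel (entry (-((d : ℤ) + 1)) c)) • _ := fun c hc =>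
      Finset.sum_congr rfl fun d hd => by rw [h2 c hc d hd]
    simp only [map_sum, map_smul]
    rw [Finset.sum_congr rfl h3]
    simp only [smul_add, smul_sub, Finset.smul_sum, smul_smul, Finset.sum_add_distrib,
      Finset.sum_sub_distrib]
    have h4 : ∀ F : ℕ → ℕ → ℕ → Wedge,
        ∑ c ∈ Finset.range N, ∑ d ∈ Finset.range N, ∑ a ∈ Finset.range N, F c d a =
        ∑ d ∈ Finset.range N, ∑ a ∈ Finset.range N, ∑ c ∈ Finset.range N, F c d a := fun F => by
      rw [Finset.sum_comm]
      exact Finset.sum_congr rfl fun d _ => Finset.sum_comm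
    have h5 : ∀ F : ℕ → ℕ → ℕ → Wedge,
        ∑ c ∈ Finset.range N, ∑ d ∈ Finset.range N, ∑ b ∈ Finset.range N, F c d b =
        ∑ c ∈ Finset.range N, ∑ b ∈ Finset.range N, ∑ d ∈ Finset.range N, F c d b := fun F =>
      Finset.sum_congr rfl fun d _ => Finset.sum_comm
    rw [h4, h5 fun c d b => (coeff p (borel (entry (-((d : ℤ) + 1)) c)) *
          coeff q (borel (entry (-((b : ℤ) + 1)) (-((d : ℤ) + 1))))) • natHook c b]
    abel
  have comm1 : ∀ (s : Finset ℕ) (F : ℕ × ℕ → ℕ → Wedge),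
      ∑ p ∈ Finset.HasAntidiagonal.antidiagonal n, ∑ x ∈ s, F p x =
        ∑ x ∈ s, ∑ p ∈ Finset.HasAntidiagonal.antidiagonal n, F p x := fun s F =>
    Finset.sum_comm
  -- Under `c ↔ a` the coefficient is symmetric by `borel_entry_hook`, while the vector changes
  -- sign.
  have hz : ∑ c ∈ Finset.range N, ∑ d ∈ Finset.range N, ∑ a ∈ Finset.range N,
      ∑ b ∈ Finset.range N, coeff n (borel (entry (-((d : ℤ) + 1)) c) *
        borel (entry (-((b : ℤ) + 1)) a)) •
          psi c (psiStar (-((d : ℤ) + 1)) (natHook a b)) = 0 := by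
    refine sum_eq_zero_of_antisymm N _ fun c d a b => ?_
    rw [natHook, natHook, psi_psiStar_hookVec (by omega) (by omega) (by omega), smul_neg]
    congr 2
    simp only [borel_entry_hook]
    congr 1
    ring
  rw [Finset.sum_congr rfl key]
  simp only [Finset.sum_add_distrib, Finset.sum_sub_distrib, comm1, ← Finset.sum_smul,
    ← coeff_mul]
  rw [hz, add_zero]
  have e1 : ∀ d a : ℕ, a ∈ Finset.range N →
      (∑ p ∈ Finset.HasAntidiagonal.antidiagonal n, ∑ c ∈ Finset.range N,
        coeff p.1 (borel (entry (-((d : ℤ) + 1)) c)) * coeff p.2 (borel (entry c a))) =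
      coeff n (borel (entry (-((d : ℤ) + 1)) a) * ∑ j ∈ Finset.range (a + 1), geom j) :=
    fun d a ha => by
      rw [Finset.sum_comm, ← sum_borel_entry_mul_nat (Finset.mem_range.1 ha), map_sum]
      simp only [coeff_mul]
  have e2 : ∀ c b : ℕ, b ∈ Finset.range N →
      (∑ p ∈ Finset.HasAntidiagonal.antidiagonal n, ∑ d ∈ Finset.range N,
        coeff p.1 (borel (entry (-((d : ℤ) + 1)) c)) *
          coeff p.2 (borel (entry (-((b : ℤ) + 1)) (-((d : ℤ) + 1))))) =
      coeff n (borel (entry (-((b : ℤ) + 1)) c) *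
        ∑ j ∈ Finset.range (b + 1), geom (-((j : ℤ) + 1))) := fun c b hb => by
    rw [Finset.sum_comm, ← sum_borel_entry_mul_neg (Finset.mem_range.1 hb), map_sum]
    simp only [coeff_mul]
  congr 1
  rw [Finset.sum_comm]
  simp only [← Finset.sum_sub_distrib, ← Finset.sum_add_distrib]
  refine Finset.sum_congr rfl fun c hc => Finset.sum_congr rfl fun d hd => ?_
  rw [e1 d c hc, e2 c d hd, ← sub_smul, ← add_smul, ← add_smul, ← map_sub, ← map_add, ← map_add]
  congr 2
  ring

theorem coeff_logHarm_sub (c d K : ℕ) :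
    coeff (K + 1) (entry (-((d : ℤ) + 1)) c * logS -
        C ((harmonic (c + d + 1) : ℚ) : ℂ) * entry (-((d : ℤ) + 1)) c) =
      -((harmonic (K + 1) : ℚ) : ℂ) * coeff (K + 1) (entry (-((d : ℤ) + 1)) c) +
        1 / 2 * (1 / ((K + 1)! : ℂ)) *
          coeff K (borel (entry (-((d : ℤ) + 1)) c) * (∑ j ∈ Finset.range (c + 1), geom j -
          ∑ j ∈ Finset.range (d + 1), geom (-((j : ℤ) + 1)) + 2 * borel mu)) := by
  have h := congrArg (coeff (K + 1)) (borel_logHarm_elt (d + 1) c)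
  rw [← entry_hook] at h
  set E := entry (-((d : ℤ) + 1)) c
  have h1 : borel E * (C ((harmonic (c + (d + 1)) : ℚ) : ℂ) +
      X * (C (1 / 2) * ∑ j ∈ Finset.range (c + 1), geom j -
        C (1 / 2) * ∑ j ∈ Finset.range (d + 1), geom (-((j : ℤ) + 1)) + borel mu)) =
      C ((harmonic (c + (d + 1)) : ℚ) : ℂ) * borel E + C (1 / 2 : ℂ) *
        (X * (borel E * (∑ j ∈ Finset.range (c + 1), geom j -
          ∑ j ∈ Finset.range (d + 1), geom (-((j : ℤ) + 1)) + 2 * borel mu))) := by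
    have h3 : C (R := ℂ) (1 / 2) * 2 = 1 := by
      rw [← map_ofNat C 2, ← map_mul]; norm_num
    linear_combination -X * borel E * borel mu * h3
  rw [h1, map_add, coeff_C_mul, coeff_C_mul, coeff_succ_X_mul, coeff_borel, coeff_borel,
    logHarm_apply, map_add, coeff_harm] at h
  have hf : ((K + 1)! : ℂ) ≠ 0 := by exact_mod_cast (K + 1).factorial_ne_zero
  rw [map_sub, coeff_C_mul, add_assoc c d 1]
  field_simp
  linear_combination 2 * h

theorem coeff_logSDiv_succ (K : ℕ) :
    coeff (K + 1) logSDiv = -((harmonic (K + 1) : ℚ) : ℂ) * coeff (K + 1) mu +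
      1 / 2 * (1 / ((K + 1)! : ℂ)) * coeff K (borel mu * borel mu) := by
  have h := congrArg (coeff (K + 1)) borel_logSDiv
  rw [coeff_C_mul, coeff_succ_X_mul, coeff_borel, map_add, coeff_harm] at h
  have hf : ((K + 1)! : ℂ) ≠ 0 := by exact_mod_cast (K + 1).factorial_ne_zero
  field_simp
  linear_combination 2 * h

/-- The vacuum row of `[z^{K+1}] (A^1(z) / z)`, expressed through the operators `A^0`. -/
theorem vacuum_relation (N K : ℕ) :
    ∑ c ∈ Finset.range N, ∑ d ∈ Finset.range N,
        coeff (K + 1) (entry (-((d : ℤ) + 1)) c * logS -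
          C ((harmonic (c + d + 1) : ℚ) : ℂ) * entry (-((d : ℤ) + 1)) c) • natHook c d +
        coeff (K + 1) logSDiv • vacVec =
      -((harmonic (K + 1) : ℚ) : ℂ) • windowA N (K + 1) vacVec +
        (1 / 2 : ℂ) • ∑ p ∈ Finset.HasAntidiagonal.antidiagonal K,
          ((p.1 ! : ℂ) * (p.2 ! : ℂ) / ((K + 1)! : ℂ)) •
            windowA N p.2 (windowA N p.1 vacVec) := by
  have h : ∀ p ∈ Finset.HasAntidiagonal.antidiagonal K,
      ((p.1 ! : ℂ) * (p.2 ! : ℂ) / ((K + 1)! : ℂ)) • windowA N p.2 (windowA N p.1 vacVec) =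
      (1 / ((K + 1)! : ℂ)) • ((p.1 ! : ℂ) * (p.2 ! : ℂ)) •
        windowA N p.2 (windowA N p.1 vacVec) := fun p _ => by
    rw [smul_smul]
    congr 1
    ring
  rw [Finset.sum_congr rfl h, ← Finset.smul_sum, sum_factorial_windowA, smul_smul, smul_add,
    windowA, window_vacVec, smul_add, add_add_add_comm]
  simp only [Finset.smul_sum, smul_smul, ← Finset.sum_add_distrib, ← add_smul,
    coeff_logHarm_sub, coeff_logSDiv_succ]

theorem coeff_zero_mu : coeff 0 mu = 0 := by
  have h := congrArg (coeff 1) varsigma_mul_mu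
  rw [← X_mul_calS, mul_assoc, show (1 : ℕ) = 0 + 1 from rfl, coeff_succ_X_mul, map_sub,
    coeff_zero_eq_constantCoeff_apply, map_mul, constantCoeff_calS, one_mul, coeff_one,
    if_neg (by norm_num)] at h
  rw [coeff_zero_eq_constantCoeff_apply, h, calS, coeff_mk, varsigma, map_sub, expz, expz,
    coeff_rescale, coeff_rescale]
  norm_num

theorem coeff_zero_entry (b a : ℤ) : coeff 0 (entry b a) = if b = a then 1 else 0 := by
  rcases lt_trichotomy b a with h | rfl | h
  · obtain ⟨n, hn⟩ : ∃ n : ℕ, (a - b).toNat = n + 1 := ⟨(a - b).toNat - 1, by omega⟩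
    rw [entry, if_pos h.le, if_neg h.ne, hn, coeff_zero_elt_succ]
  · rw [entry, if_pos le_rfl, if_pos rfl, sub_self, Int.toNat_zero, coeff_zero_elt_zero]
  · rw [entry_of_lt h, if_neg h.ne', map_zero]

/-- At order `z^0` the operator is the charge of the window, which vanishes on the vacuum and on
hooks. This removes the boundary terms `p = 0` and `q = 0` of the quadratic sum. -/
theorem windowA_zero_vacVec (N : ℕ) : windowA N 0 vacVec = 0 := by
  rw [windowA, window_vacVec, coeff_zero_mu, zero_smul, add_zero]
  refine Finset.sum_eq_zero fun c _ => Finset.sum_eq_zero fun d _ => ?_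
  rw [coeff_zero_entry, if_neg (by omega), zero_smul]

theorem windowA_zero_natHook {N c d : ℕ} (hc : c < N) (hd : d < N) :
    windowA N 0 (natHook c d) = 0 := by
  rw [windowA, window_natHook hc hd _ _ fun b a h => by rw [entry_of_lt h, map_zero],
    coeff_zero_mu, zero_smul, add_zero]
  have h2 : ∀ b : ℕ, (-((b : ℤ) + 1) = -((d : ℤ) + 1) ↔ b = d) := fun b => by omega
  have h3 : ∀ a b : ℕ, ¬(-((b : ℤ) + 1) = a) := fun a b => by omega
  simp only [coeff_zero_entry, h2, h3, Nat.cast_inj, ite_smul, one_smul, zero_smul, if_false,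
    Finset.sum_const_zero, add_zero, Finset.sum_ite_eq, Finset.sum_ite_eq', Finset.mem_range, hc,
    hd, if_true, sub_self]

theorem windowA_zero_windowA_vacVec (N p : ℕ) : windowA N 0 (windowA N p vacVec) = 0 := by
  conv_lhs => rw [windowA.eq_def N p, window_vacVec]
  rw [map_add, map_sum, map_smul, windowA_zero_vacVec, smul_zero, add_zero]
  refine Finset.sum_eq_zero fun c hc => ?_
  rw [map_sum]
  refine Finset.sum_eq_zero fun d hd => ?_
  rw [map_smul, windowA_zero_natHook (Finset.mem_range.1 hc) (Finset.mem_range.1 hd), smul_zero]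

/-! ### Rows of the operators `A^j_i` -/

/-- The row of `A^j_i` at `S`, as a vector of the infinite wedge space. -/
def rowVec (j : ℕ) (i : ℤ) (S : Config) : Wedge :=
  Finsupp.ofSupportFinite (coeffA j i S) (coeffA_finite j i S)

theorem rowVec_apply (j : ℕ) (i : ℤ) (S T : Config) : rowVec j i S T = coeffA j i S T := rfl

theorem rowVec_eq_sum (j : ℕ) (i : ℤ) (S : Config) :
    rowVec j i S = ∑ T ∈ (coeffA_finite j i S).toFinset, coeffA j i S T • basisVec T := by
  classical
  ext T
  simp only [Finsupp.coe_finsetSum, Finset.sum_apply, Finsupp.smul_apply, basisVec,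
    Finsupp.single_apply, smul_eq_mul, mul_ite, mul_one, mul_zero, Finset.sum_ite_eq',
    rowVec_apply, Set.Finite.mem_toFinset, Set.mem_ofPred_eq]
  split_ifs with h
  · rfl
  · exact not_not.1 h

/-- The linear functional `v_S ↦ x_S` given by an element `x` of the completion. -/
def pairing (x : Completion) : Wedge →ₗ[ℂ] ℂ := Finsupp.linearCombination ℂ x

theorem pairing_basisVec (x : Completion) (S : Config) : pairing x (basisVec S) = x S := by
  simp [pairing, basisVec]

theorem A_apply (j : ℕ) (i : ℤ) (x : Completion) (S : Config) :
    A j i x S = pairing x (rowVec j i S) := by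
  rw [rowVec_eq_sum, map_sum]
  simp only [map_smul, pairing_basisVec, smul_eq_mul]
  rfl

/-- The symmetric bilinear form for which the `v_S` are orthonormal. -/
def dot : Wedge →ₗ[ℂ] Wedge →ₗ[ℂ] ℂ :=
  Finsupp.linearCombination ℂ fun S : Config => Finsupp.lapply (R := ℂ) S

theorem dot_basisVec_left (S : Config) (y : Wedge) : dot (basisVec S) y = y S := by
  simp [dot, basisVec]

theorem dot_basisVec_right (x : Wedge) (T : Config) : dot x (basisVec T) = x T := by
  classical
  have : dot.flip (basisVec T) = Finsupp.lapply (R := ℂ) T := by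
    refine Finsupp.lhom_ext' fun S => LinearMap.ext_ring ?_
    change dot (basisVec S) (basisVec T) = basisVec S T
    rw [dot_basisVec_left, basisVec, basisVec, Finsupp.single_apply, Finsupp.single_apply]
    simp only [eq_comm]
  exact LinearMap.congr_fun this x

theorem dot_psi (k : ℤ) (x y : Wedge) : dot (psi k x) y = dot x (psiStar k y) := by
  have : dot.comp (psi k) = (dot.compl₂ (psiStar k)) := by
    refine Finsupp.lhom_ext' fun S => LinearMap.ext_ring ?_
    refine Finsupp.lhom_ext' fun T => LinearMap.ext_ring ?_
    change dot (psi k (basisVec S)) (basisVec T) = dot (basisVec S) (psiStar k (basisVec T))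
    rw [dot_basisVec_left, dot_basisVec_right, psiStar_adjoint]
  exact LinearMap.congr_fun (LinearMap.congr_fun this x) y

theorem dot_comm (x y : Wedge) : dot x y = dot y x := by
  have : dot = dot.flip := by
    refine Finsupp.lhom_ext' fun S => LinearMap.ext_ring ?_
    refine Finsupp.lhom_ext' fun T => LinearMap.ext_ring ?_
    change dot (basisVec S) (basisVec T) = dot (basisVec T) (basisVec S)
    rw [dot_basisVec_left, dot_basisVec_right]
  exact LinearMap.congr_fun (LinearMap.congr_fun this x) y

theorem dot_psiStar (k : ℤ) (x y : Wedge) : dot (psiStar k x) y = dot x (psi k y) := by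
  rw [dot_comm, ← dot_psi, dot_comm]

theorem matUnit_of_ne {a b : ℤ} (h : a ≠ b) (x : Wedge) :
    matUnit a b x = psi a (psiStar b x) := by
  rw [matUnit_apply]
  split_ifs
  · rfl
  · rw [psi_psiStar, if_neg h, zero_sub]

/-- The matrix units `:ψ_i ψ_j*:` and `:ψ_j ψ_i*:` are adjoint. -/
theorem matUnit_adjoint (a b : ℤ) (S T : Config) :
    matUnit a b (basisVec T) S = matUnit b a (basisVec S) T := by
  rw [← dot_basisVec_left S, ← dot_basisVec_left T, dot_comm (basisVec T)]
  by_cases h : a = b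
  · subst h
    rw [matUnit_apply, matUnit_apply]
    split_ifs
    · rw [← dot_psiStar, ← dot_psi]
    · rw [map_neg, map_neg, LinearMap.neg_apply, ← dot_psi, ← dot_psiStar]
  · rw [matUnit_of_ne h, matUnit_of_ne (Ne.symm h), ← dot_psiStar, ← dot_psi]

/-- Far above and far below, `S` agrees with the vacuum. This bounds one side of each index;
triangularity up to a finite shift (`weight_eq_zero`) bounds the other. -/
theorem exists_matUnit_bound (S : Config) :
    ∃ B : ℕ, ∀ a b, matUnit a b (basisVec S) ≠ 0 → b < B ∧ -(B : ℤ) ≤ a := by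
  classical
  obtain ⟨U, hU⟩ := S.exists_upper
  obtain ⟨L, hL⟩ := S.exists_lower
  refine ⟨U.natAbs + L.natAbs + 1, fun a b h => ?_⟩
  by_cases hab : a = b
  · subst hab
    rw [matUnit_apply] at h
    split_ifs at h with ha
    · rw [psiStar_basisVec] at h
      split_ifs at h with hS
      · have := hU a hS
        omega
      · simp at h
    · rw [psi_basisVec] at h
      split_ifs at h with hS
      · simp at h
      · have := hL a hS
        omega
  · obtain ⟨T, hT⟩ : ∃ T, matUnit a b (basisVec S) T ≠ 0 := by
      by_contra hc
      push Not at hc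
      exact h (Finsupp.ext hc)
    obtain ⟨h1, h2, -⟩ := matUnit_ne_zero (Ne.symm hab) (matUnit_adjoint a b T S ▸ hT)
    have := hU b h1
    have := hL a h2
    omega

/-- The coefficient of `t^j` in the factor of `𝓔_n(z)` in `A(z)`. -/
def tFactor (j : ℕ) (n : ℤ) : LaurentSeries ℂ :=
  toLaurent (X ^ j * coeff j (prefactor n)) * toLaurent varsigma ^ n

/-- The coefficient in `A^j_i` of the matrix unit that moves `a` to `b`. -/
def weight (j : ℕ) (i b a : ℤ) : ℂ :=
  (tFactor j (a - b) *
    toLaurent (expz ((a : ℂ) + 1 / 2 - ((a - b : ℤ) : ℂ) / 2))).coeff (i + 1)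

/-- The scalar term of `A^j_i`. -/
def scalarTerm (j : ℕ) (i : ℤ) : ℂ := (tFactor j 0 * (toLaurent varsigma)⁻¹).coeff (i + 1)

theorem coeff_toLaurent_natCast (f : PowerSeries ℂ) (n : ℕ) :
    (toLaurent f).coeff (n : ℤ) = coeff n f := by
  rw [PowerSeries.coeff_coe, if_neg (by omega), Int.natAbs_natCast]

theorem coeff_toLaurent_of_neg (f : PowerSeries ℂ) {n : ℤ} (h : n < 0) :
    (toLaurent f).coeff n = 0 := by
  rw [PowerSeries.coeff_coe, if_pos h]

/-- The factor `ς^{a-b}` is divisible by `z^{a-b}`. -/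
theorem weight_eq_zero (j : ℕ) {i a b : ℤ} (h : 0 < a - b) (h' : i + 1 < a - b) :
    weight j i b a = 0 := by
  obtain ⟨n, hn⟩ := Int.eq_ofNat_of_zero_le h.le
  rw [weight, tFactor, hn, zpow_natCast, ← X_mul_calS, ← map_pow, ← map_mul, ← map_mul]
  rcases lt_or_ge (i + 1) 0 with hi | hi
  · exact coeff_toLaurent_of_neg _ hi
  · obtain ⟨p, hp⟩ := Int.eq_ofNat_of_zero_le hi
    rw [hp, coeff_toLaurent_natCast, mul_pow]
    rw [show ∀ f g h k : PowerSeries ℂ, f * (g * h) * k = g * (f * h * k) by intros; ring,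
      coeff_X_pow_mul', if_neg (by omega)]

/-- The coefficient functional that defines `A^j_i`. -/
def coeffHom (j : ℕ) (i : ℤ) : PowerSeries (LaurentSeries ℂ) →+ ℂ where
  toFun F := (coeff j (rescale (toLaurent X) F)).coeff (i + 1)
  map_zero' := by simp
  map_add' F G := by simp

theorem coeffHom_apply (j : ℕ) (i n : ℤ) (S T : Config) :
    coeffHom j i (PowerSeries.map toLaurent (prefactor n) *
        C (toLaurent varsigma ^ n * calE n S T)) =
      (tFactor j n * calE n S T).coeff (i + 1) := by
  change (coeff j (rescale (toLaurent X) (PowerSeries.map toLaurent (prefactor n) *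
        C (toLaurent varsigma ^ n * calE n S T)))).coeff (i + 1) = _
  rw [coeff_rescale, coeff_mul_C, coeff_map, tFactor, map_mul, map_pow]
  congr 1
  ring

/-- Multiplication by a Laurent series and extraction of a coefficient. -/
def mulCoeffHom (F : LaurentSeries ℂ) (i : ℤ) : PowerSeries ℂ →+ ℂ where
  toFun f := (F * toLaurent f).coeff i
  map_zero' := by simp
  map_add' f g := by simp [mul_add]

theorem finite_support_calE_term (n : ℤ) (S T : Config) :
    (Function.support fun m : ℤ => (matUnit (m - n) m (basisVec T) S) •
      expz ((m : ℂ) + 1 / 2 - (n : ℂ) / 2)).Finite := by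
  obtain ⟨B, hB⟩ := exists_matUnit_bound S
  refine (Set.finite_Ico (-(B : ℤ)) (B + n)).subset fun m hm => ?_
  rw [Function.mem_support, matUnit_adjoint] at hm
  have := hB m (m - n) fun h => hm (by rw [h]; simp)
  rw [Set.mem_Ico]
  omega

open scoped Classical in
theorem coeff_mul_calE (j : ℕ) (i n : ℤ) (S T : Config) :
    (tFactor j n * calE n S T).coeff (i + 1) =
      ∑ᶠ m : ℤ, weight j i (m - n) m * matUnit m (m - n) (basisVec S) T +
        if n = 0 ∧ S = T then scalarTerm j i else 0 := by
  rw [calE, mul_add, HahnSeries.coeff_add]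
  congr 1
  · change mulCoeffHom (tFactor j n) (i + 1) _ = _
    rw [AddMonoidHom.map_finsum _ (finite_support_calE_term n S T)]
    refine finsum_congr fun m => ?_
    rw [weight, sub_sub_cancel, ← matUnit_adjoint]
    change (tFactor j n * toLaurent (_ • _)).coeff (i + 1) = _
    rw [smul_eq_C_mul, map_mul, HahnSeries.ofPowerSeries_C, mul_left_comm,
      HahnSeries.C_mul_eq_smul, HahnSeries.coeff_smul, smul_eq_mul, mul_comm]
  · split_ifs with h
    · rw [scalarTerm, h.1]
    · simp

theorem finite_support_twoParamA (S T : Config) :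
    (Function.support fun n : ℤ => PowerSeries.map toLaurent (prefactor n) *
      C (toLaurent varsigma ^ n * calE n S T)).Finite := by
  obtain ⟨B, hB⟩ := exists_matUnit_bound S
  obtain ⟨B', hB'⟩ := exists_matUnit_bound T
  refine (Set.finite_Icc (-2 * (B : ℤ)) (2 * B')).subset fun n hn => ?_
  rw [Set.mem_Icc]
  by_contra hc
  refine hn ?_
  have hE : calE n S T = 0 := by
    rw [calE, if_neg (by omega), add_zero, finsum_eq_zero_of_forall_eq_zero, map_zero]
    intro m
    by_cases h : matUnit (m - n) m (basisVec T) S = 0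
    · rw [h, zero_smul]
    · exfalso
      have h1 := hB' (m - n) m fun h' => h (by rw [h']; rfl)
      rw [matUnit_adjoint] at h
      have h2 := hB m (m - n) fun h' => h (by rw [h']; rfl)
      omega
  change _ * C (_ * calE n S T) = 0
  rw [hE, mul_zero, map_zero, mul_zero]

open scoped Classical in
theorem coeffA_eq_finsum (j : ℕ) (i : ℤ) (S T : Config) :
    coeffA j i S T = ∑ᶠ n : ℤ, (∑ᶠ m : ℤ,
      weight j i (m - n) m * matUnit m (m - n) (basisVec S) T +
        if n = 0 ∧ S = T then scalarTerm j i else 0) := by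
  change coeffHom j i (twoParamA S T) = _
  rw [twoParamA, AddMonoidHom.map_finsum _ (finite_support_twoParamA S T)]
  exact finsum_congr fun n => by rw [coeffHom_apply, coeff_mul_calE]

theorem eventually_rowVec_eq (j : ℕ) (i : ℤ) (S : Config) :
    ∀ᶠ N : ℕ in Filter.atTop,
      rowVec j i S = window N (weight j i) (scalarTerm j i) (basisVec S) := by
  classical
  obtain ⟨B, hB⟩ := exists_matUnit_bound S
  refine Filter.eventually_atTop.2 ⟨B + i.natAbs + 2, fun N hN => ?_⟩
  ext T
  have hsupp : ∀ a b, weight j i b a * matUnit a b (basisVec S) T ≠ 0 →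
      a ∈ Finset.Ico (-(N : ℤ)) N ∧ b ∈ Finset.Ico (-(N : ℤ)) N := by
    intro a b h
    have h1 := hB a b fun h' => h (by rw [h']; simp)
    have h2 : ¬(0 < a - b ∧ i + 1 < a - b) := fun h' => h (by
      rw [weight_eq_zero j h'.1 h'.2, zero_mul])
    rw [Finset.mem_Ico, Finset.mem_Ico]
    omega
  -- The double sum over the degree `n` and the position `m` becomes a sum over matrix units via `n
  -- = a - b`, `m = a`.
  set e : ℤ × ℤ ≃ ℤ × ℤ :=
    { toFun := fun p => (p.1 - p.2, p.1)
      invFun := fun p => (p.2, p.2 - p.1)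
      left_inv := fun p => by simp
      right_inv := fun p => by simp } with he
  set h : ℤ × ℤ → ℂ := fun p =>
    weight j i (p.2 - p.1) p.2 * matUnit p.2 (p.2 - p.1) (basisVec S) T with hh
  have hcomp : ∀ p, h (e p) = weight j i p.2 p.1 * matUnit p.1 p.2 (basisVec S) T := fun p => by
    simp [hh, he]
  have hsub : (Function.support fun p => h (e p)) ⊆
      ((Finset.Ico (-(N : ℤ)) N ×ˢ Finset.Ico (-(N : ℤ)) N : Finset (ℤ × ℤ)) : Set (ℤ × ℤ)) := by
    intro p hp
    rw [Function.mem_support, hcomp] at hp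
    rw [Finset.mem_coe, Finset.mem_product]
    exact hsupp _ _ hp
  have hfin : (Function.support h).Finite := by
    have := ((Finset.finite_toSet _).subset hsub).image e
    refine this.subset fun p hp => ⟨e.symm p, ?_, e.apply_symm_apply p⟩
    rw [Function.mem_support, e.apply_symm_apply]
    exact hp
  have hfin2 : (Function.support fun n : ℤ => ∑ᶠ m : ℤ, h (n, m)).Finite := by
    refine (hfin.image Prod.fst).subset fun n hn => ?_
    obtain ⟨m, hm⟩ : ∃ m, h (n, m) ≠ 0 := by
      by_contra hc
      push Not at hc
      exact hn (finsum_eq_zero_of_forall_eq_zero hc)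
    exact ⟨(n, m), hm, rfl⟩
  have hfin3 : (Function.support fun n : ℤ =>
      if n = 0 ∧ S = T then scalarTerm j i else 0).Finite := by
    refine (Set.finite_singleton 0).subset fun n hn => ?_
    by_contra h0
    exact hn (if_neg fun h => h0 h.1)
  rw [rowVec_apply, coeffA_eq_finsum]
  change ∑ᶠ n : ℤ, (∑ᶠ m : ℤ, h (n, m) + if n = 0 ∧ S = T then scalarTerm j i else 0) = _
  rw [finsum_add_distrib hfin2 hfin3, ← finsum_curry h hfin, ← finsum_comp_equiv e,
    finsum_eq_sum_of_support_subset _ hsub, Finset.sum_product, window_apply,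
    finsum_eq_single _ 0 fun n hn => if_neg fun h => hn h.1]
  simp only [hcomp, true_and, Finsupp.add_apply, Finsupp.coe_finsetSum, Finset.sum_apply,
    Finsupp.smul_apply, smul_eq_mul, basisVec, Finsupp.single_apply, mul_ite, mul_one, mul_zero]

/-! ### The coefficients of `A^0` and `A^1` -/

theorem pochInv_natCast (n : ℕ) :
    pochInv n = (∏ j ∈ Finset.range n, (X + C ((j : ℂ) + 1)))⁻¹ := by
  rw [pochInv, if_pos (Int.natCast_nonneg n), Int.toNat_natCast]

theorem coeff_zero_prod (n : ℕ) :
    coeff 0 (∏ j ∈ Finset.range n, ((X : PowerSeries ℂ) + C ((j : ℂ) + 1))) = (n ! : ℂ) := by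
  induction n with
  | zero => simp
  | succ n ih =>
    rw [coeff_zero_eq_constantCoeff] at ih
    rw [Finset.prod_range_succ, coeff_zero_eq_constantCoeff, map_mul, ih, Nat.factorial_succ]
    simp
    ring

theorem coeff_one_prod (n : ℕ) :
    coeff 1 (∏ j ∈ Finset.range n, ((X : PowerSeries ℂ) + C ((j : ℂ) + 1))) =
      (n ! : ℂ) * ((harmonic n : ℚ) : ℂ) := by
  induction n with
  | zero => simp [coeff_one]
  | succ n ih =>
    have h : (n : ℂ) + 1 ≠ 0 := by exact_mod_cast n.succ_ne_zero
    rw [Finset.prod_range_succ, mul_add, map_add, coeff_mul_C, ih, ← zero_add 1,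
      coeff_succ_mul_X, coeff_zero_prod, Nat.factorial_succ, zero_add, harmonic_succ]
    push_cast
    field_simp
    ring

theorem coeff_zero_pochInv (n : ℕ) : coeff 0 (pochInv n) = 1 / (n ! : ℂ) := by
  have h := coeff_zero_prod n
  rw [coeff_zero_eq_constantCoeff_apply] at h
  rw [pochInv_natCast, coeff_zero_eq_constantCoeff_apply, constantCoeff_inv, h, one_div]

theorem coeff_one_pochInv (n : ℕ) :
    coeff 1 (pochInv n) = -((harmonic n : ℚ) : ℂ) * (1 / (n ! : ℂ)) := by
  have hf : (n ! : ℂ) ≠ 0 := by exact_mod_cast n.factorial_ne_zero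
  have h := coeff_zero_pochInv n
  rw [pochInv_natCast] at h ⊢
  set f := ∏ j ∈ Finset.range n, ((X : PowerSeries ℂ) + C ((j : ℂ) + 1)) with hfdef
  have h1 : f * f⁻¹ = 1 := PowerSeries.mul_inv_cancel _ (by
    rw [← coeff_zero_eq_constantCoeff_apply, hfdef, coeff_zero_prod]; exact hf)
  have h2 := congrArg (coeff 1) h1
  rw [coeff_mul, show Finset.HasAntidiagonal.antidiagonal 1 = {(0, 1), (1, 0)} from rfl,
    Finset.sum_pair (by simp), coeff_zero_prod, coeff_one_prod, h, coeff_one,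
    if_neg one_ne_zero] at h2
  field_simp at h2 ⊢
  linear_combination h2

/-- The factor with `j = 0` is `X` itself. Hence `A^0` contains no negative degrees and is
triangular. -/
theorem coeff_zero_pochInv_of_neg {n : ℤ} (hn : n < 0) : coeff 0 (pochInv n) = 0 := by
  obtain ⟨m, hm⟩ : ∃ m : ℕ, (-n).toNat = m + 1 := ⟨(-n).toNat - 1, by omega⟩
  rw [pochInv, if_neg hn.not_ge, hm, Finset.prod_range_succ', coeff_zero_eq_constantCoeff_apply,
    map_mul]
  simp

theorem coeff_zero_prefactor (n : ℤ) : coeff 0 (prefactor n) = C (coeff 0 (pochInv n)) := by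
  rw [prefactor, coeff_mul]
  simp [coeff_rescale]

theorem coeff_one_prefactor (n : ℕ) :
    coeff 1 (prefactor n) =
      C (1 / (n ! : ℂ)) * (logS - C ((harmonic n : ℚ) : ℂ)) := by
  rw [prefactor, coeff_mul, show Finset.HasAntidiagonal.antidiagonal 1 = {(0, 1), (1, 0)} from rfl,
    Finset.sum_pair (by simp), coeff_map, coeff_map, coeff_zero_pochInv, coeff_one_pochInv,
    coeff_rescale, coeff_rescale, coeff_exp, coeff_exp, ← logS]
  simp only [map_mul, map_neg, pow_zero, pow_one, Nat.factorial_zero, Nat.factorial_one,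
    Nat.cast_one, div_one, map_one]
  ring

theorem varsigma_pow_mul_expz (b : ℤ) (n : ℕ) :
    C (1 / (n ! : ℂ)) * varsigma ^ n * expz ((b : ℂ) + 1 / 2 + n / 2) = elt b n := by
  have h : varsigma * expz (1 / 2) = expz 1 - 1 := by
    rw [varsigma, sub_mul, ← expz_add, ← expz_add]; norm_num [expz_zero]
  have h2 : ∀ n : ℕ, expz ((n : ℂ) / 2) = expz (1 / 2) ^ n := by
    intro n
    induction n with
    | zero => simp [expz_zero]
    | succ n ih =>
      rw [pow_succ, ← ih, ← expz_add]
      congr 1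
      push_cast
      ring
  rw [elt, smul_eq_C_mul, expz_add _ ((n : ℂ) / 2), h2, ← h]
  ring

theorem coeff_X_mul_toLaurent (f : PowerSeries ℂ) (i : ℤ) :
    (toLaurent (X * f)).coeff (i + 1) = (toLaurent f).coeff i := by
  rcases lt_trichotomy i (-1) with h | rfl | h
  · rw [coeff_toLaurent_of_neg _ (by omega), coeff_toLaurent_of_neg _ (by omega)]
  · rw [coeff_toLaurent_of_neg f (by omega)]
    change (toLaurent (X * f)).coeff ((0 : ℕ) : ℤ) = 0
    rw [coeff_toLaurent_natCast, coeff_zero_X_mul]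
  · obtain ⟨n, rfl⟩ := Int.eq_ofNat_of_zero_le (show 0 ≤ i by omega)
    change (toLaurent (X * f)).coeff ((n + 1 : ℕ) : ℤ) = _
    rw [coeff_toLaurent_natCast, coeff_toLaurent_natCast, coeff_succ_X_mul]

theorem exponent_eq (b : ℤ) (n : ℕ) :
    (((b + n : ℤ) : ℂ) + 1 / 2 - ((b + n - b : ℤ) : ℂ) / 2) = (b : ℂ) + 1 / 2 + n / 2 := by
  push_cast
  ring

theorem weight_zero (i b a : ℤ) : weight 0 i b a = (toLaurent (entry b a)).coeff (i + 1) := by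
  rcases lt_or_ge a b with h | h
  · rw [entry_of_lt h, weight, tFactor, coeff_zero_prefactor,
      coeff_zero_pochInv_of_neg (by omega)]
    simp
  · obtain ⟨n, rfl⟩ : ∃ n : ℕ, a = b + n := ⟨(a - b).toNat, by omega⟩
    have h1 : b + (n : ℤ) - b = n := by ring
    rw [entry, if_pos h, weight, tFactor, exponent_eq, h1, zpow_natCast, ← map_pow, ← map_mul,
      ← map_mul, coeff_zero_prefactor, coeff_zero_pochInv, pow_zero, one_mul,
      varsigma_pow_mul_expz, Int.toNat_natCast]

/-- The factor `z` from `a = tz` cancels the index shift in `z^{i+1}`. The case `b ≤ a` suffices,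
because the vacuum row only involves `b < 0 ≤ a`. -/
theorem weight_one {i b a : ℤ} (h : b ≤ a) :
    weight 1 i b a = (toLaurent (entry b a * logS -
      C ((harmonic (a - b).toNat : ℚ) : ℂ) * entry b a)).coeff i := by
  obtain ⟨n, rfl⟩ : ∃ n : ℕ, a = b + n := ⟨(a - b).toNat, by omega⟩
  have h1 : b + (n : ℤ) - b = n := by ring
  rw [entry, if_pos h, weight, tFactor, exponent_eq, h1, zpow_natCast, ← map_pow, ← map_mul,
    ← map_mul, coeff_one_prefactor, pow_one, mul_assoc, mul_assoc, coeff_X_mul_toLaurent,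
    Int.toNat_natCast, ← varsigma_pow_mul_expz]
  congr 2
  ring

theorem inv_toLaurent_varsigma :
    (toLaurent varsigma)⁻¹ = toLaurent mu + (toLaurent X)⁻¹ := by
  have hX : toLaurent X ≠ 0 := by
    rw [Ne, map_eq_zero_iff _ HahnSeries.ofPowerSeries_injective]
    exact X_ne_zero
  apply inv_eq_of_mul_eq_one_left
  rw [add_mul, ← map_mul, mul_comm mu, varsigma_mul_mu, ← X_mul_calS,
    map_mul, inv_mul_cancel_left₀ hX, map_sub, map_one, sub_add_cancel]

theorem coeff_inv_toLaurent_X (p : ℕ) : ((toLaurent X)⁻¹ : LaurentSeries ℂ).coeff p = 0 := by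
  rw [toLaurent, HahnSeries.ofPowerSeries_X, HahnSeries.inv_single,
    HahnSeries.coeff_single_of_ne (by omega)]

/-- The index `p - 1` selects `z^p` with `p ≥ 0`, so the polar part `1 / z` of `1 / ς` never
contributes. -/
theorem scalarTerm_zero (p : ℕ) : scalarTerm 0 ((p : ℤ) - 1) = coeff p mu := by
  have h : tFactor 0 0 = 1 := by
    have := coeff_zero_pochInv 0
    rw [Nat.cast_zero] at this
    rw [tFactor, coeff_zero_prefactor, this]
    simp
  rw [scalarTerm, h, one_mul, inv_toLaurent_varsigma, sub_add_cancel, HahnSeries.coeff_add,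
    coeff_toLaurent_natCast, coeff_inv_toLaurent_X, add_zero]

theorem scalarTerm_one (i : ℤ) : scalarTerm 1 i = (toLaurent logSDiv).coeff i := by
  have h0 : toLaurent varsigma ≠ 0 := by
    rw [Ne, map_eq_zero_iff _ HahnSeries.ofPowerSeries_injective]
    exact varsigma_ne_zero
  have h1 := coeff_one_prefactor 0
  rw [Nat.cast_zero] at h1
  have h : tFactor 1 0 * (toLaurent varsigma)⁻¹ = toLaurent (X * logSDiv) := by
    rw [mul_inv_eq_iff_eq_mul₀ h0, ← map_mul, tFactor, h1, zpow_zero, mul_one, mul_assoc,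
      mul_comm logSDiv, varsigma_mul_logSDiv]
    simp
  rw [scalarTerm, h, coeff_X_mul_toLaurent]

theorem window_weight_zero (N p : ℕ) :
    window N (weight 0 ((p : ℤ) - 1)) (scalarTerm 0 ((p : ℤ) - 1)) = windowA N p := by
  rw [windowA, scalarTerm_zero]
  congr 1
  funext b a
  rw [weight_zero, sub_add_cancel, coeff_toLaurent_natCast]

theorem window_weight_one (N : ℕ) (i : ℤ) :
    window N (weight 1 i) (scalarTerm 1 i) vacVec =
      ∑ c ∈ Finset.range N, ∑ d ∈ Finset.range N,
        (toLaurent (entry (-((d : ℤ) + 1)) c * logS -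
          C ((harmonic (c + d + 1) : ℚ) : ℂ) * entry (-((d : ℤ) + 1)) c)).coeff i • natHook c d +
        (toLaurent logSDiv).coeff i • vacVec := by
  rw [window_vacVec, scalarTerm_one]
  congr 1
  refine Finset.sum_congr rfl fun c _ => Finset.sum_congr rfl fun d _ => ?_
  rw [weight_one (by omega), show ((c : ℤ) - -((d : ℤ) + 1)).toNat = c + d + 1 by omega]

theorem window_weight_one_of_nonpos (N : ℕ) {i : ℤ} (hi : i ≤ 0) :
    window N (weight 1 i) (scalarTerm 1 i) vacVec = 0 := by
  have h : ∀ f : PowerSeries ℂ, coeff 0 f = 0 → (toLaurent f).coeff i = 0 := fun f hf => by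
    rcases hi.lt_or_eq with h | rfl
    · exact coeff_toLaurent_of_neg _ h
    · exact (coeff_toLaurent_natCast f 0).trans hf
  have h1 : coeff 0 logSDiv = 0 := by
    have h1 := congrArg (coeff 1) varsigma_mul_logSDiv
    have h2 := congrArg (coeff 0) borel_logSDiv
    rw [coeff_C_mul, coeff_zero_X_mul, coeff_borel, map_add, coeff_harm] at h2
    simpa using h2
  rw [window_weight_one, h _ h1, zero_smul, add_zero]
  refine Finset.sum_eq_zero fun c _ => Finset.sum_eq_zero fun d _ => ?_
  have h2 : coeff 0 (entry (-((d : ℤ) + 1)) c) = 0 := by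
    rw [coeff_zero_entry, if_neg (by omega)]
  rw [h, zero_smul]
  rw [coeff_zero_eq_constantCoeff_apply] at h2 ⊢
  rw [map_sub, map_mul, map_mul, h2, zero_mul, mul_zero, sub_zero]

/-! ### The relation -/

/-- Rows compose in the opposite order to operators. One `N` serves all configurations in the finite
row of the left factor. -/
theorem eventually_A_zero_mul (p q : ℕ) (x : Completion) :
    ∀ᶠ N : ℕ in Filter.atTop,
      (A 0 ((p : ℤ) - 1) (A 0 ((q : ℤ) - 1) x)) Config.vacuum =
        pairing x (windowA N q (windowA N p vacVec)) := by
  have h1 : ∀ᶠ N : ℕ in Filter.atTop,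
      ∀ T ∈ (coeffA_finite 0 ((p : ℤ) - 1) Config.vacuum).toFinset,
        rowVec 0 ((q : ℤ) - 1) T = windowA N q (basisVec T) := by
    rw [Filter.eventually_all_finset]
    intro T _
    filter_upwards [eventually_rowVec_eq 0 ((q : ℤ) - 1) T] with N hN
    rw [hN, window_weight_zero]
  filter_upwards [h1, eventually_rowVec_eq 0 ((p : ℤ) - 1) Config.vacuum] with N hN hp
  rw [window_weight_zero] at hp
  rw [A_apply, vacVec, ← hp, rowVec_eq_sum, map_sum, map_sum, map_sum]
  refine Finset.sum_congr rfl fun T hT => ?_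
  rw [map_smul, map_smul, map_smul, pairing_basisVec, A_apply, hN T hT]

theorem sum_Icc_one_div (k : ℕ) :
    ∑ j ∈ Finset.Icc (1 : ℤ) k, 1 / (j : ℂ) = ((harmonic k : ℚ) : ℂ) := by
  induction k with
  | zero => simp
  | succ k ih =>
    have h : Finset.Icc (1 : ℤ) (k + 1 : ℕ) = insert ((k : ℤ) + 1) (Finset.Icc (1 : ℤ) k) := by
      ext x
      simp only [Finset.mem_Icc, Finset.mem_insert]
      omega
    rw [h, Finset.sum_insert (by simp), ih, harmonic_succ]
    push_cast
    ring

/-- Passage from powers of `z` to operator indices: `p = i + 1` and `q = K - 1 - i`. -/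
theorem sum_antidiagonal_eq_sum_Icc (K : ℕ) (F : ℕ → ℕ → ℂ) (h1 : F 0 K = 0) (h2 : F K 0 = 0) :
    ∑ p ∈ Finset.HasAntidiagonal.antidiagonal K, F p.1 p.2 =
      ∑ i ∈ Finset.Icc (0 : ℤ) (K - 2), F (i + 1).toNat (K - 1 - i).toNat := by
  rw [← Finset.sum_filter_of_ne (p := fun p : ℕ × ℕ => p.1 ≠ 0 ∧ p.2 ≠ 0)]
  · refine Finset.sum_nbij' (fun p => (p.1 : ℤ) - 1)
      (fun i => ((i + 1).toNat, ((K : ℤ) - 1 - i).toNat)) ?_ ?_ ?_ ?_ ?_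
    · rintro ⟨p, q⟩ h
      rw [Finset.mem_filter, Finset.HasAntidiagonal.mem_antidiagonal] at h
      rw [Finset.mem_Icc]
      dsimp only at h ⊢
      omega
    · intro i h
      rw [Finset.mem_Icc] at h
      rw [Finset.mem_filter, Finset.HasAntidiagonal.mem_antidiagonal]
      dsimp only
      omega
    · rintro ⟨p, q⟩ h
      rw [Finset.mem_filter, Finset.HasAntidiagonal.mem_antidiagonal] at h
      dsimp only at h ⊢
      rw [Prod.mk.injEq]
      omega
    · intro i h
      rw [Finset.mem_Icc] at h
      dsimp only
      omega
    · rintro ⟨p, q⟩ h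
      rw [Finset.mem_filter, Finset.HasAntidiagonal.mem_antidiagonal] at h
      dsimp only at h ⊢
      congr 1 <;> omega
  · rintro ⟨p, q⟩ h hF
    rw [Finset.HasAntidiagonal.mem_antidiagonal] at h
    dsimp only at h hF ⊢
    constructor
    · rintro rfl
      rw [zero_add] at h
      exact hF (h ▸ h1)
    · rintro rfl
      rw [add_zero] at h
      exact hF (h ▸ h2)

/-- The relation between the vacuum rows of `A^1` and `A^0`, for a vector of the completion. -/
theorem A_one_vacuum (k : ℤ) (x : Completion) :
    A 1 k x Config.vacuum =
      -(∑ j ∈ Finset.Icc (1 : ℤ) k, 1 / (j : ℂ)) * A 0 (k - 1) x Config.vacuum +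
        1 / 2 * ∑ i ∈ Finset.Icc (0 : ℤ) (k - 3),
          (((i + 1).toNat ! : ℂ) * ((k - i - 2).toNat ! : ℂ) / (k.toNat ! : ℂ)) *
            (A 0 i (A 0 (k - i - 3) x)) Config.vacuum := by
  rcases le_or_gt k 0 with hk | hk
  -- For `k ≤ 0` both sums are empty and the vacuum row of `A^1_k` vanishes.
  · obtain ⟨N, hN⟩ := (eventually_rowVec_eq 1 k Config.vacuum).exists
    rw [A_apply, hN, ← vacVec, window_weight_one_of_nonpos N hk, map_zero,
      Finset.Icc_eq_empty (by omega), Finset.Icc_eq_empty (by omega)]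
    simp
  · obtain ⟨K, rfl⟩ : ∃ K : ℕ, k = (K + 1 : ℕ) := ⟨(k - 1).toNat, by omega⟩
    have hev : ∀ᶠ N : ℕ in Filter.atTop, ∀ i ∈ Finset.Icc (0 : ℤ) (K - 2),
        (A 0 i (A 0 (((K + 1 : ℕ) : ℤ) - i - 3) x)) Config.vacuum =
          pairing x (windowA N (K - 1 - i).toNat (windowA N (i + 1).toNat vacVec)) := by
      rw [Filter.eventually_all_finset]
      intro i hi
      rw [Finset.mem_Icc] at hi
      have := eventually_A_zero_mul (i + 1).toNat (K - 1 - i).toNat x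
      rwa [show ((i + 1).toNat : ℤ) - 1 = i by omega,
        show (((K : ℤ) - 1 - i).toNat : ℤ) - 1 = ((K + 1 : ℕ) : ℤ) - i - 3 by
          push_cast; omega] at this
    obtain ⟨N, hN, hN1, hN0⟩ := (hev.and ((eventually_rowVec_eq 1 (K + 1 : ℕ) Config.vacuum).and
      (eventually_rowVec_eq 0 (((K + 1 : ℕ) : ℤ) - 1) Config.vacuum))).exists
    rw [window_weight_zero] at hN0
    have hrel := congrArg (pairing x) (vacuum_relation N K)
    simp only [← coeff_toLaurent_natCast] at hrel
    rw [← window_weight_one, vacVec, ← hN1, ← hN0, ← A_apply, map_add, map_smul, map_smul,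
      ← A_apply, map_sum] at hrel
    rw [hrel, sum_Icc_one_div, smul_eq_mul, smul_eq_mul]
    congr 2
    simp only [map_smul, smul_eq_mul]
    rw [sum_antidiagonal_eq_sum_Icc K fun p q => ((p ! : ℂ) * (q ! : ℂ) / ((K + 1)! : ℂ)) *
      pairing x (windowA N q (windowA N p (basisVec Config.vacuum)))]
    · rw [show ((K + 1 : ℕ) : ℤ) - 3 = (K : ℤ) - 2 by push_cast; ring]
      refine Finset.sum_congr rfl fun i hi => ?_
      rw [hN i hi, vacVec, Int.toNat_natCast,
        show ((K + 1 : ℕ) : ℤ) - i - 2 = (K : ℤ) - 1 - i by push_cast; ring]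
    -- The two end terms contain the charge operator applied to vectors of charge zero.
    · rw [← vacVec, windowA_zero_vacVec, map_zero, map_zero, mul_zero]
    · rw [← vacVec, windowA_zero_windowA_vacVec, map_zero, mul_zero]

end

end InfWedge

theorem mainTheorem7 (k : ℤ) (L : List (Fin 2 × ℤ)) :
    (InfWedge.vev (InfWedge.A 1 k * InfWedge.word L) =
      -(∑ j ∈ Finset.Icc (1 : ℤ) k, 1 / (j : ℂ)) *
          InfWedge.vev (InfWedge.A 0 (k - 1) * InfWedge.word L) +
        1 / 2 * ∑ i ∈ Finset.Icc (0 : ℤ) (k - 3),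
          (((i + 1).toNat ! : ℂ) * ((k - i - 2).toNat ! : ℂ) / (k.toNat ! : ℂ)) *
            InfWedge.vev (InfWedge.A 0 i * InfWedge.A 0 (k - i - 3) * InfWedge.word L)) ∧
    (∀ w : InfWedge.Completion,
      InfWedge.bracket (InfWedge.A 1 k * InfWedge.word L) w =
        -(∑ j ∈ Finset.Icc (1 : ℤ) k, 1 / (j : ℂ)) *
            InfWedge.bracket (InfWedge.A 0 (k - 1) * InfWedge.word L) w +
          1 / 2 * ∑ i ∈ Finset.Icc (0 : ℤ) (k - 3),
            (((i + 1).toNat ! : ℂ) * ((k - i - 2).toNat ! : ℂ) / (k.toNat ! : ℂ)) *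
              InfWedge.bracket (InfWedge.A 0 i * InfWedge.A 0 (k - i - 3) * InfWedge.word L) w) :=
  ⟨InfWedge.A_one_vacuum k (InfWedge.word L InfWedge.vac),
    fun w => InfWedge.A_one_vacuum k (InfWedge.word L w)⟩
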